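/- Fix $\alpha\in(0,1)$, $\beta\in(0,1-\alpha)$, $p\in(0,1]$, for every $n\ge 1$ a dimension $m=m(n)\ge 1$ (for instance constant), and for every $n\ge 1$ a probability distribution $\nu_n$ on $[n]=\{1,\dots,n\}$ (the prescribed law of initial ranks). Let $S$ be the unit cube of dimension $m$ with the torus metric derived from $L_\infty$ and with the uniform probability measure. Consider the Markov chain whose states consist of $n$ nodes placed at points of $S$, a bijective ranking of the nodes by $[n]$, and a graph on the nodes. The influence region of a node of rank $r$ is the ball around it of volume $r^{-\alpha}n^{-\beta}$. In each time-step: 1. a new node $v$ is placed uniformly at random in $S$ and, independently for each of the $n$ present nodes $u$ such that $v$ lies in the influence region of $u$ (with respect to the current ranks), an edge $vu$ is created with probability $p$; 2. one of the $n$ nodes present before the step is chosen uniformly at random and deleted with all its incident edges; 3. the new node receives a rank $R$ drawn from $\nu_n$, and the surviving nodes are re-ranked by $[n]\setminus\{R\}$ in the same relative order as before. The choices of position, edge coins, deleted node and initial rank are independent of each other and of the past. Nodes are identified only through their ranks, so two states that differ by a relabelling of the nodes are the same. For every $n\ge1$ this chain has exactly one stationary probability distribution; the random graph on $n$ nodes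 with this law is $\mathrm{GEO\text{-}P}(\alpha,\beta,m,p)$. An event $A_n$ holds with extreme probability (wep) if there is a constant $c>0$ such that $\mathbb P(A_n)\ge 1-\exp(-c\log^2 n)$ for all sufficiently large $n$. **Theorem.** There is a deterministic sequence $\varepsilon_n\to0$ such that wep the average degree $d=2|E|/n$ of $\mathrm{GEO\text{-}P}(\alpha,\beta,m,p)$ satisfies $$\left|\,d-\frac{p}{1-\alpha}\,n^{1-\alpha-\beta}\right|\le\varepsilon_n\,\frac{p}{1-\alpha}\,n^{1-\alpha-\beta},$$ that is, wep $d=(1+o(1))\frac{p}{1-\alpha}n^{1-\alpha-\beta}$. Moreover the model satisfies a densification power law with exponent $a=2-\alpha-\beta\in(1,2)$: there is a constant $C>0$ such that wep $|E|=(1+o(1))\,C\,n^{a}$, where again $o(1)$ is a deterministic sequence tending to $0$. -/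

import Mathlib

open MeasureTheory ProbabilityTheory Filter Topology

noncomputable section

namespace GeoP

/-- The unit hypercube of dimension `m` with opposite faces identified. Its distance is the
maximum over the coordinates of the distance on the circle `ℝ / ℤ`, i.e. the torus metric derived
from the `L_∞` metric, and its `volume` is the uniform probability measure. -/
abbrev Torus (m : ℕ) : Type := Fin m → UnitAddCircle

/-- The rank in `{1, …, n}` that belongs to an index `r : Fin n`. -/
def rank {n : ℕ} (r : Fin n) : ℝ := ((r : ℕ) : ℝ) + 1

/-- The influence region of a node of rank `rank r` placed at `x`: the ball around `x` of volume
`(rank r) ^ (-α) * n ^ (-β)`. A ball of the torus is a cube, so its radius is half of the `m`-th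
root of its volume; see `volume_influenceRegion`. -/
def influenceRegion {n m : ℕ} (α β : ℝ) (x : Torus m) (r : Fin n) : Set (Torus m) :=
  Metric.closedBall x (((rank r) ^ (-α) * (n : ℝ) ^ (-β)) ^ ((m : ℝ)⁻¹) / 2)

theorem one_le_rank {n : ℕ} (r : Fin n) : 1 ≤ rank r := by
  simp [rank]

/-- The influence region has the prescribed volume. -/
theorem volume_influenceRegion {n m : ℕ} (hm : 1 ≤ m) {α β : ℝ} (hα : 0 ≤ α) (hβ : 0 ≤ β)
    (x : Torus m) (r : Fin n) :
    volume (influenceRegion α β x r) = ENNReal.ofReal ((rank r) ^ (-α) * (n : ℝ) ^ (-β)) := by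
  have hn : (1 : ℝ) ≤ n := by exact_mod_cast r.pos
  have hr := one_le_rank r
  set v : ℝ := (rank r) ^ (-α) * (n : ℝ) ^ (-β) with hv
  have hv0 : 0 ≤ v := by positivity
  have hv1 : v ≤ 1 := mul_le_one₀ (Real.rpow_le_one_of_one_le_of_nonpos hr (by linarith))
    (by positivity) (Real.rpow_le_one_of_one_le_of_nonpos hn (by linarith))
  have hs0 : 0 ≤ v ^ ((m : ℝ)⁻¹) := by positivity
  have hs1 : v ^ ((m : ℝ)⁻¹) ≤ 1 := Real.rpow_le_one hv0 hv1 (by positivity)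
  rw [influenceRegion, closedBall_pi _ (by positivity), volume_pi_pi]
  simp only [AddCircle.volume_closedBall, Finset.prod_const, Finset.card_univ, Fintype.card_fin]
  rw [mul_div_cancel₀ _ two_ne_zero, min_eq_right hs1, ← ENNReal.ofReal_pow hs0,
    Real.rpow_inv_natCast_pow hv0 (by omega)]

/-- The rank, after a time-step, of a node that had rank `r` before it, when the node of rank `D` is
deleted and the new node is inserted with rank `R`: first every rank larger than `D` decreases by
one to close the gap, then every rank that is now at least `R` increases by one to make room for the
new node. -/
def newRank (D R r : ℕ) : ℕ :=
  let s := if D < r then r - 1 else r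
  if R ≤ s then s + 1 else s

/-- The change of all ranks in one time-step, as a permutation. The place `D` of the deleted node
is taken over by the new node and is sent to `R`; all other ranks change by `newRank`. -/
def rankPerm {n : ℕ} (D R : Fin n) : Equiv.Perm (Fin n) where
  toFun r := if h : r = D then R else ⟨newRank D R r, by
    have := r.2; have := D.2; have := R.2
    have : (r : ℕ) ≠ D := fun e => h (Fin.ext e)
    simp only [newRank]; split_ifs <;> omega⟩
  invFun r := if h : r = R then D else ⟨newRank R D r, by
    have := r.2; have := D.2; have := R.2
    have : (r : ℕ) ≠ R := fun e => h (Fin.ext e)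
    simp only [newRank]; split_ifs <;> omega⟩
  left_inv r := by
    apply Fin.ext
    by_cases h : r = D
    · simp [h]
    · have h' : (r : ℕ) ≠ D := fun e => h (Fin.ext e)
      have hne : newRank D R r ≠ R := by
        simp only [newRank]; split_ifs <;> omega
      simp only [h, dite_false, Fin.ext_iff, hne]
      simp only [newRank]; split_ifs <;> omega
  right_inv r := by
    apply Fin.ext
    by_cases h : r = R
    · simp [h]
    · have h' : (r : ℕ) ≠ R := fun e => h (Fin.ext e)
      have hne : newRank R D r ≠ D := by
        simp only [newRank]; split_ifs <;> omega
      simp only [h, dite_false, Fin.ext_iff, hne]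
      simp only [newRank]; split_ifs <;> omega

theorem rankPerm_deleted {n : ℕ} (D R : Fin n) : rankPerm D R D = R := by
  simp [rankPerm]

/-- The surviving nodes keep their order. -/
theorem rankPerm_lt_iff {n : ℕ} (D R a b : Fin n) (ha : a ≠ D) (hb : b ≠ D) :
    rankPerm D R a < rankPerm D R b ↔ a < b := by
  simp only [rankPerm, newRank, Equiv.coe_fn_mk, ha, hb, dite_false, Fin.lt_def]
  have : (a : ℕ) ≠ D := fun e => ha (Fin.ext e)
  have : (b : ℕ) ≠ D := fun e => hb (Fin.ext e)
  split_ifs <;> omega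

/-- A state of the process: the positions of the `n` nodes and the graph on them. The ranking is a
bijection between the nodes and `{1, …, n}` at every time, so a node is addressed by its current
rank: the index `r : Fin n` stands for the node of rank `rank r`. -/
abbrev State (n m : ℕ) : Type := (Fin n → Torus m) × SimpleGraph (Fin n)

/-- The randomness of one time-step: the position `y` of the new node, one coin for every present
node, the rank `D` of the deleted node, and the initial rank `R` of the new node. -/
abbrev Innovation (n m : ℕ) : Type := Torus m × (Fin n → Bool) × Fin n × Fin n

/-- The new position, coins, deletion and initial rank are independent; the position is uniform,
the coins show `true` with probability `p`, the deleted node is uniform among the `n` present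
ones, and the initial rank has the prescribed law `ν`. -/
def innovationLaw {n : ℕ} (m : ℕ) (p : unitInterval) (ν : Measure (Fin n)) :
    Measure (Innovation n m) :=
  (volume : Measure (Torus m)).prod
    ((Measure.pi fun _ : Fin n => bernoulliMeasure true false p).prod
      ((uniformOn (Set.univ : Set (Fin n))).prod ν))

theorem isProbabilityMeasure_innovationLaw {n : ℕ} (hn : 1 ≤ n) (m : ℕ) (p : unitInterval)
    (ν : Measure (Fin n)) [IsProbabilityMeasure ν] :
    IsProbabilityMeasure (innovationLaw m p ν) := by
  have : Nonempty (Fin n) := ⟨⟨0, hn⟩⟩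
  have : IsProbabilityMeasure (uniformOn (Set.univ : Set (Fin n))) :=
    isProbabilityMeasure_uniformOn Set.finite_univ Set.univ_nonempty
  have : IsProbabilityMeasure (volume : Measure (Torus m)) := by
    refine ⟨?_⟩
    rw [volume_pi, Measure.pi_univ]
    simp
  unfold innovationLaw
  infer_instance

/-- The graph after a time-step, addressed by the old ranks, with the new node in the place `D` of
the deleted one: edges between survivors are kept, the edges at the deleted node are removed, and
the new node at `y` is joined to each survivor `b` with `y` in the influence region of `b` and
whose coin shows `true`. -/
def stepGraph {n m : ℕ} (α β : ℝ) (s : State n m) (ω : Innovation n m) :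
    SimpleGraph (Fin n) :=
  let D := ω.2.2.1
  SimpleGraph.fromRel fun a b =>
    (a ≠ D ∧ b ≠ D ∧ s.2.Adj a b) ∨
    (a = D ∧ ω.2.1 b = true ∧ ω.1 ∈ influenceRegion α β (s.1 b) b)

/-- One time-step of the process. -/
def step {n m : ℕ} (α β : ℝ) (s : State n m) (ω : Innovation n m) : State n m :=
  let σ := (rankPerm ω.2.2.1 ω.2.2.2).symm
  (fun k => Function.update s.1 ω.2.2.1 ω.1 (σ k), (stepGraph α β s ω).comap σ)

theorem measurable_step {n m : ℕ} (α β : ℝ) :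
    Measurable fun q : State n m × Innovation n m => step α β q.1 q.2 := by
  have hkey : ∀ D R : Fin n, Measurable fun q : State n m × (Torus m × (Fin n → Bool)) =>
      step α β q.1 (q.2.1, q.2.2, D, R) := by
    intro D R
    refine Measurable.prodMk ?_ ?_
    · refine measurable_pi_lambda _ fun k => ?_
      by_cases h : (rankPerm D R).symm k = D
      · simp only [h, Function.update_self]; fun_prop
      · simp only [Function.update_of_ne h]; fun_prop
    · refine SimpleGraph.measurable_iff_adj.2 fun a b => ?_
      have hadj : ∀ a b : Fin n, MeasurableSet
          {q : State n m × (Torus m × (Fin n → Bool)) | q.1.2.Adj a b} := by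
        intro a b
        exact measurableSet_setOfPred.2 (SimpleGraph.measurable_iff_adj.1 (by fun_prop) a b)
      have hcoin : ∀ b : Fin n, MeasurableSet
          {q : State n m × (Torus m × (Fin n → Bool)) | q.2.2 b = true} := by
        intro b
        exact measurableSet_eq_fun (by fun_prop) (by fun_prop)
      have hreg : ∀ b : Fin n, MeasurableSet
          {q : State n m × (Torus m × (Fin n → Bool)) |
            q.2.1 ∈ influenceRegion α β (q.1.1 b) b} := by
        intro b
        simp only [influenceRegion, Metric.mem_closedBall]
        exact measurableSet_le (by fun_prop) (by fun_prop)
      have hrel : ∀ a b : Fin n, MeasurableSet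
          {q : State n m × (Torus m × (Fin n → Bool)) |
            (a ≠ D ∧ b ≠ D ∧ q.1.2.Adj a b) ∨
            (a = D ∧ q.2.2 b = true ∧ q.2.1 ∈ influenceRegion α β (q.1.1 b) b)} := by
        intro a b
        exact ((MeasurableSet.const _).inter ((MeasurableSet.const _).inter (hadj a b))).union
          ((MeasurableSet.const _).inter ((hcoin b).inter (hreg b)))
      set σ := (rankPerm D R).symm with hσ
      exact measurableSet_setOfPred.1 ((MeasurableSet.const (σ a ≠ σ b)).inter
        ((hrel (σ a) (σ b)).union (hrel (σ b) (σ a))))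
  have hcount : Measurable fun q : (State n m × (Torus m × (Fin n → Bool))) × (Fin n × Fin n) =>
      step α β q.1.1 (q.1.2.1, q.1.2.2, q.2.1, q.2.2) :=
    measurable_from_prod_countable_left fun d => hkey d.1 d.2
  exact hcount.comp (g := fun q : (State n m × (Torus m × (Fin n → Bool))) × (Fin n × Fin n) =>
      step α β q.1.1 (q.1.2.1, q.1.2.2, q.2.1, q.2.2))
    (f := fun q : State n m × Innovation n m =>
      ((q.1, (q.2.1, q.2.2.1)), q.2.2.2)) (by fun_prop)

/-- The transition kernel of the Markov chain of states: from `s` the chain moves to `step α β s ω`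
with a fresh innovation `ω`. -/
def transition {n : ℕ} (m : ℕ) (α β : ℝ) (p : unitInterval) (ν : Measure (Fin n)) :
    Kernel (State n m) (State n m) :=
  (Kernel.id ×ₖ Kernel.const _ (innovationLaw m p ν)).map fun q => step α β q.1 q.2

/-- The kernel moves `s` to `step α β s ω`, where `ω` has law `innovationLaw m p ν`. -/
theorem transition_apply {n m : ℕ} (hn : 1 ≤ n) (α β : ℝ) (p : unitInterval)
    (ν : Measure (Fin n)) [IsProbabilityMeasure ν] (s : State n m) :
    transition m α β p ν s = (innovationLaw m p ν).map (step α β s) := by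
  have := isProbabilityMeasure_innovationLaw hn m p ν
  rw [transition, Kernel.map_apply _ (measurable_step α β), Kernel.prod_apply, Kernel.id_apply,
    Kernel.const_apply, Measure.dirac_prod,
    Measure.map_map (measurable_step α β) (by fun_prop)]
  rfl

/-- `π` is the law of GEO-P`(α, β, m, p)` on `n` nodes with initial rank law `ν` : a stationary
distribution of the chain. -/
structure IsGeoP {n m : ℕ} (α β : ℝ) (p : unitInterval) (ν : Measure (Fin n))
    (π : Measure (State n m)) : Prop where
  isProbabilityMeasure : IsProbabilityMeasure π
  invariant : Kernel.Invariant (transition m α β p ν) π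

/-- The number of edges. -/
def numEdges {n : ℕ} (G : SimpleGraph (Fin n)) : ℝ := (G.edgeSet.ncard : ℝ)

/-- The average degree `2 |E| / n`. -/
def avgDegree {n : ℕ} (G : SimpleGraph (Fin n)) : ℝ := 2 * numEdges G / n

/-- The events `A n` hold with extreme probability: the probability of `A n` is at least
`1 - exp (-Θ(log² n))` as `n → ∞`. -/
def WithExtremeProbability {Ω : ℕ → Type*} [∀ n, MeasurableSpace (Ω n)]
    (μ : ∀ n, Measure (Ω n)) (A : ∀ n, Set (Ω n)) : Prop :=
  ∃ c : ℝ, 0 < c ∧ ∀ᶠ n : ℕ in atTop, 1 - Real.exp (-(c * Real.log n ^ 2)) ≤ (μ n).real (A n)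

/-- With extreme probability `X n = (1 + o(1)) x n`, where `o(1)` is a deterministic sequence that
tends to `0`. -/
def WepAsymptotic {Ω : ℕ → Type*} [∀ n, MeasurableSpace (Ω n)]
    (μ : ∀ n, Measure (Ω n)) (X : ∀ n, Ω n → ℝ) (x : ℕ → ℝ) : Prop :=
  ∃ ε : ℕ → ℝ, Tendsto ε atTop (𝓝 0) ∧
    WithExtremeProbability μ fun n => {s | |X n s - x n| ≤ ε n * x n}

/-- The random graphs, with states of law `μ n`, satisfy a densification power law with exponent
`a ∈ (1, 2)`: with extreme probability their number of edges is asymptotically proportional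
to `n ^ a`. -/
def DensificationPowerLaw {m : ℕ → ℕ} (μ : ∀ n, Measure (State n (m n))) (a : ℝ) : Prop :=
  1 < a ∧ a < 2 ∧ ∃ C : ℝ, 0 < C ∧
    WepAsymptotic μ (fun _ s => numEdges s.2) fun n => C * (n : ℝ) ^ a

end GeoP

end

/-! The number of edges Q has an exactly linear drift. One step adds the degree of the new node and
subtracts the degree of the deleted one. Every rank is occupied at every time and the volume of a
region depends only on the rank. So, given any state, the new degree has the same mean M =
`meanNewDeg`, whatever the positions and `ν`. A uniformly deleted node has mean degree 2Q/n. The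
drift is therefore -(2/n)(Q - q) with q = nM/2 = `meanEdges`, and an elementary estimate of ∑ r^(-α)
gives q ~ p/(2(1-α)) n^(2-α-β).

Concentration around q comes from stationarity: a step does not change the mean of a function of the
state. Applied to an exponential of ±θ(Q - q) and expanded to second order, this gives an integral
inequality (`IsGeoP.integral_exp_mul_le`) in which the linear drift competes with a second-order
term of size θB(q + Q). A bound on large deviations follows (`IsGeoP.exp_mul_measureReal_le`).

The expansion requires increments of size at most B, which holds unless some degree exceeds B. Large
degrees are again excluded by stationarity, now for ∑ exp(θ deg) (`IsGeoP.integral_expDeg_le`). A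
term disappears with probability 1/n and otherwise grows in mean by a relative amount of at most
1/(2n). The term of the new node has bounded mean because stationary positions are independent and
uniform (`IsGeoP.map_fst`). The exponential of Q is made linear beyond a level L (`cappedExp`), so
that the rare event of a large degree costs only exp(θL) times a polynomial in n.

Existence and uniqueness follow by coupling. Two copies driven by the same innovations can differ
only at nodes present since the start, and the expected number of these after t steps is n(1 -
1/n)^t. -/

open scoped ENNReal

noncomputable section

namespace GeoP

variable {n m : ℕ} {α β : ℝ}

/-! ### Setwise limits of probability measures -/

/-- A sequence of probability measures that is uniformly Cauchy on measurable sets has a limit,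
with the same rate. -/
theorem exists_setwise_limit {Ω : Type*} [MeasurableSpace Ω] (μ : ℕ → Measure Ω)
    [∀ t, IsProbabilityMeasure (μ t)] (ρ : ℕ → ℝ) (hρ : Tendsto ρ atTop (𝓝 0))
    (h : ∀ t t', t ≤ t' → ∀ B, MeasurableSet B → |(μ t).real B - (μ t').real B| ≤ ρ t) :
    ∃ π : Measure Ω, IsProbabilityMeasure π ∧
      ∀ t B, MeasurableSet B → |(μ t).real B - π.real B| ≤ ρ t := by
  have hlim : ∀ B, MeasurableSet B → ∃ l, Tendsto (fun t => (μ t).real B) atTop (𝓝 l) := by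
    intro B hB
    refine cauchySeq_tendsto_of_complete (cauchySeq_of_le_tendsto_0 (fun t => 2 * ρ t) ?_ ?_)
    · intro a b N ha hb
      have h1 := h N a ha B hB
      have h2 := h N b hb B hB
      rw [Real.dist_eq]
      rw [abs_le] at *
      constructor <;> linarith
    · simpa using hρ.const_mul 2
  choose! l hl using hlim
  have hl0 : ∀ B, MeasurableSet B → 0 ≤ l B := fun B hB =>
    ge_of_tendsto' (hl B hB) fun t => measureReal_nonneg
  have hclose : ∀ t B, MeasurableSet B → |(μ t).real B - l B| ≤ ρ t := by
    intro t B hB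
    refine le_of_tendsto ((tendsto_const_nhds.sub (hl B hB)).abs) ?_
    filter_upwards [eventually_ge_atTop t] with t' ht' using h t t' ht' B hB
  -- Countable additivity survives the limit because the rate is uniform over all measurable sets:
  -- one fixed `μ t` approximates `l` both on the whole union and on every partial union, and `μ t`
  -- is itself countably additive.
  have hsum : ∀ f : ℕ → Set Ω, (∀ i, MeasurableSet (f i)) → Pairwise (Function.onFun Disjoint f) →
      HasSum (fun i => l (f i)) (l (⋃ i, f i)) := by
    intro f hf hd
    rw [hasSum_iff_tendsto_nat_of_nonneg fun i => hl0 _ (hf i)]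
    have hpart : ∀ N, ∑ i ∈ Finset.range N, l (f i) = l (⋃ i ∈ Finset.range N, f i) := by
      intro N
      refine tendsto_nhds_unique (tendsto_finsetSum _ fun i _ => hl _ (hf i)) ?_
      refine (hl _ (Finset.measurableSet_biUnion _ fun i _ => hf i)).congr fun t => ?_
      exact measureReal_biUnion_finset (fun i _ j _ hij => hd hij) fun i _ => hf i
    rw [Metric.tendsto_atTop]
    intro ε hε
    obtain ⟨t, ht⟩ := ((tendsto_order.1 hρ).2 (ε / 3) (by positivity)).exists
    have htsum : HasSum (fun i => (μ t).real (f i)) ((μ t).real (⋃ i, f i)) := by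
      rw [measureReal_def, measure_iUnion hd hf]
      have hne : ∑' i, μ t (f i) ≠ ∞ := by
        rw [← measure_iUnion hd hf]; exact measure_ne_top _ _
      rw [ENNReal.tsum_toReal_eq fun i => measure_ne_top _ _]
      exact (ENNReal.summable_toReal hne).hasSum
    have := htsum.tendsto_sum_nat
    rw [Metric.tendsto_atTop] at this
    obtain ⟨N, hN⟩ := this (ε / 3) (by positivity)
    refine ⟨N, fun k hk => ?_⟩
    have h1 := hN k hk
    rw [← measureReal_biUnion_finset (fun i _ j _ hij => hd hij) fun i _ => hf i] at h1
    have h2 := hclose t _ (MeasurableSet.iUnion hf)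
    have h3 := hclose t _ (Finset.measurableSet_biUnion (Finset.range k) fun i _ => hf i)
    rw [hpart, Real.dist_eq]
    rw [Real.dist_eq] at h1
    rw [abs_lt] at *
    rw [abs_le] at h2 h3
    constructor <;> linarith [h1.1, h1.2, h2.1, h2.2, h3.1, h3.2]
  have hempty : l ∅ = 0 := tendsto_nhds_unique (hl ∅ .empty) (by simp)
  have huniv : l Set.univ = 1 := tendsto_nhds_unique (hl _ .univ) (by simp)
  let π : Measure Ω := Measure.ofMeasurable (fun B _ => ENNReal.ofReal (l B)) (by simp [hempty])
    (by
      intro f hf hd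
      have hs := hsum f hf hd
      rw [← hs.tsum_eq, ENNReal.ofReal_tsum_of_nonneg (fun i => hl0 _ (hf i)) hs.summable])
  have hπ : ∀ B, MeasurableSet B → π B = ENNReal.ofReal (l B) := fun B hB =>
    Measure.ofMeasurable_apply B hB
  refine ⟨π, ⟨by rw [hπ _ .univ, huniv]; simp⟩, fun t B hB => ?_⟩
  rw [measureReal_def, measureReal_def, hπ B hB, ENNReal.toReal_ofReal (hl0 B hB)]
  exact hclose t B hB

/-- Setwise comparison of two measures carries over to functions with values in `[0, 1]`. -/
theorem lintegral_le_add_of_forall_measure_le {Ω : Type*} [MeasurableSpace Ω] {μ ν : Measure Ω}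
    {r : ℝ≥0∞} (h : ∀ B, MeasurableSet B → μ B ≤ ν B + r) {g : Ω → ℝ≥0∞} (hg : Measurable g)
    (hg1 : ∀ x, g x ≤ 1) : ∫⁻ x, g x ∂μ ≤ (∫⁻ x, g x ∂ν) + r := by
  -- Layer-cake formula. As `g ≤ 1`, only levels in (0, 1) contribute, so the error `r` is
  -- integrated over an interval of length one.
  have hrepr : ∀ ξ : Measure Ω, ∫⁻ x, g x ∂ξ = ∫⁻ t in Set.Ioi 0, ξ {x | t < (g x).toReal} := by
    intro ξ
    rw [← lintegral_eq_lintegral_meas_lt ξ (Eventually.of_forall fun x => ENNReal.toReal_nonneg)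
      hg.ennreal_toReal.aemeasurable]
    refine lintegral_congr fun x => (ENNReal.ofReal_toReal ?_).symm
    exact ((hg1 x).trans_lt ENNReal.one_lt_top).ne
  rw [hrepr, hrepr]
  calc ∫⁻ t in Set.Ioi 0, μ {x | t < (g x).toReal}
      ≤ ∫⁻ t in Set.Ioi 0, (ν {x | t < (g x).toReal} +
          (Set.Ioo (0 : ℝ) 1).indicator (fun _ => r) t) := by
        refine setLIntegral_mono' measurableSet_Ioi fun t ht => ?_
        by_cases h1 : t < (1 : ℝ)
        · rw [Set.indicator_of_mem (show t ∈ Set.Ioo (0 : ℝ) 1 from ⟨ht, h1⟩)]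
          exact h _ (measurableSet_lt measurable_const hg.ennreal_toReal)
        · have : {x | t < (g x).toReal} = ∅ := by
            ext x
            simp only [Set.mem_ofPred_eq, Set.mem_empty_iff_false, iff_false, not_lt]
            have : (g x).toReal ≤ 1 := ENNReal.toReal_le_of_le_ofReal zero_le_one (by simpa using hg1 x)
            linarith
          simp [this]
    _ = (∫⁻ t in Set.Ioi 0, ν {x | t < (g x).toReal}) +
          ∫⁻ t in Set.Ioi 0, (Set.Ioo (0 : ℝ) 1).indicator (fun _ => r) t :=
        lintegral_add_right _ (measurable_const.indicator measurableSet_Ioo)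
    _ ≤ _ := by
        gcongr
        refine (setLIntegral_le_lintegral _ _).trans ?_
        rw [lintegral_indicator measurableSet_Ioo]
        simp

/-! ### Coupling by common innovations -/

/-- The expectation of `f` after one time-step from `s`, when the innovation has law `P`. -/
def stepMean (α β : ℝ) (P : Measure (Innovation n m)) (f : State n m → ℝ≥0∞) (s : State n m) :
    ℝ≥0∞ :=
  ∫⁻ ω, f (step α β s ω) ∂P

theorem measurable_stepMean {P : Measure (Innovation n m)} [SFinite P] {f : State n m → ℝ≥0∞}
    (hf : Measurable f) : Measurable (stepMean α β P f) :=
  (hf.comp (measurable_step α β)).lintegral_prod_right'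

theorem measurable_stepMean_iterate {P : Measure (Innovation n m)} [SFinite P]
    {f : State n m → ℝ≥0∞} (hf : Measurable f) (t : ℕ) :
    Measurable ((stepMean α β P)^[t] f) := by
  induction t with
  | zero => exact hf
  | succ t ih => rw [Function.iterate_succ_apply']; exact measurable_stepMean ih

/-- Two states agree at all nodes outside `U`. -/
def AgreeOff (U : Finset (Fin n)) (s s' : State n m) : Prop :=
  (∀ k ∉ U, s.1 k = s'.1 k) ∧ ∀ a ∉ U, ∀ b ∉ U, (s.2.Adj a b ↔ s'.2.Adj a b)

theorem AgreeOff.eq_of_empty {s s' : State n m} (h : AgreeOff ∅ s s') : s = s' := by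
  refine Prod.ext (funext fun k => h.1 k (by simp)) ?_
  ext a b
  exact h.2 a (by simp) b (by simp)

/-- After a time-step the nodes at which two states can disagree are the survivors among those at
which they disagreed before. -/
theorem AgreeOff.step {U : Finset (Fin n)} {s s' : State n m} (h : AgreeOff U s s')
    (ω : Innovation n m) :
    AgreeOff ((U.erase ω.2.2.1).map (rankPerm ω.2.2.1 ω.2.2.2).toEmbedding)
      (GeoP.step α β s ω) (GeoP.step α β s' ω) := by
  have key : ∀ k, k ∉ (U.erase ω.2.2.1).map (rankPerm ω.2.2.1 ω.2.2.2).toEmbedding →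
      (rankPerm ω.2.2.1 ω.2.2.2).symm k = ω.2.2.1 ∨ (rankPerm ω.2.2.1 ω.2.2.2).symm k ∉ U := by
    intro k hk
    by_contra! hc
    exact hk (Finset.mem_map.2 ⟨_, Finset.mem_erase.2 ⟨hc.1, hc.2⟩, by simp⟩)
  constructor
  · intro k hk
    simp only [GeoP.step]
    by_cases hD : (rankPerm ω.2.2.1 ω.2.2.2).symm k = ω.2.2.1
    · rw [hD]; simp
    · rw [Function.update_of_ne hD, Function.update_of_ne hD]
      exact h.1 _ ((key k hk).resolve_left hD)
  -- Position, coins and ranks are shared by both copies, so an edge from the new node to `b` can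
  -- differ only if the positions of `b` differ.
  · have hrel : ∀ a b, (a = ω.2.2.1 ∨ a ∉ U) → (b = ω.2.2.1 ∨ b ∉ U) → a ≠ b →
        (((a ≠ ω.2.2.1 ∧ b ≠ ω.2.2.1 ∧ s.2.Adj a b) ∨
          (a = ω.2.2.1 ∧ ω.2.1 b = true ∧ ω.1 ∈ influenceRegion α β (s.1 b) b)) ↔
        ((a ≠ ω.2.2.1 ∧ b ≠ ω.2.2.1 ∧ s'.2.Adj a b) ∨
          (a = ω.2.2.1 ∧ ω.2.1 b = true ∧ ω.1 ∈ influenceRegion α β (s'.1 b) b))) := by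
      intro a b ha hb hab
      by_cases haD : a = ω.2.2.1
      · have hbD : b ≠ ω.2.2.1 := fun e => hab (haD.trans e.symm)
        rw [h.1 b (hb.resolve_left hbD)]
        simp [haD]
      · by_cases hbD : b = ω.2.2.1
        · simp [haD, hbD]
        · have := h.2 a (ha.resolve_left haD) b (hb.resolve_left hbD)
          simp [haD, hbD, this]
    intro a ha b hb
    simp only [GeoP.step, SimpleGraph.comap_adj, stepGraph, SimpleGraph.fromRel_adj]
    refine and_congr_right fun hne => or_congr ?_ ?_
    · exact hrel _ _ (key a ha) (key b hb) hne
    · exact hrel _ _ (key b hb) (key a ha) hne.symm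

/-- Coalescence: two copies of the chain run with the same innovations differ only at nodes that
have survived since the start. -/
theorem stepMean_iterate_le {P : Measure (Innovation n m)} [IsProbabilityMeasure P] {c : ℝ≥0∞}
    (hc : ∀ u, P {ω | ω.2.2.1 ≠ u} ≤ c) {f : State n m → ℝ≥0∞} (hf : Measurable f)
    (hf1 : ∀ s, f s ≤ 1) (t : ℕ) (U : Finset (Fin n)) (s s' : State n m) (h : AgreeOff U s s') :
    (stepMean α β P)^[t] f s ≤ (stepMean α β P)^[t] f s' + U.card * c ^ t := by
  induction t generalizing U s s' with
  | zero =>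
    rcases U.eq_empty_or_nonempty with rfl | hU
    · simp [h.eq_of_empty]
    · refine (hf1 s).trans (le_add_left ?_)
      simpa using hU.card_pos
  | succ t ih =>
    have hmeas : ∀ r : State n m, Measurable fun ω => (stepMean α β P)^[t] f (GeoP.step α β r ω) :=
      fun r => (measurable_stepMean_iterate hf t).comp
        ((measurable_step α β).comp measurable_prodMk_left)
    have hD : ∀ u : Fin n, MeasurableSet {ω : Innovation n m | ω.2.2.1 ≠ u} := fun u =>
      (measurableSet_eq_fun (by fun_prop) measurable_const).compl
    simp only [Function.iterate_succ_apply']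
    calc stepMean α β P ((stepMean α β P)^[t] f) s
        ≤ ∫⁻ ω, ((stepMean α β P)^[t] f (GeoP.step α β s' ω) +
            (U.erase ω.2.2.1).card * c ^ t) ∂P := by
          refine lintegral_mono fun ω => ?_
          have := ih _ _ _ (h.step (α := α) (β := β) ω)
          rwa [Finset.card_map] at this
      _ = stepMean α β P ((stepMean α β P)^[t] f) s' +
            ∫⁻ ω, ((U.erase ω.2.2.1).card * c ^ t) ∂P := lintegral_add_left (hmeas s') _
      _ ≤ _ := by
          gcongr
          -- Linearity of expectation: each node of `U` survives with probability at most `c`, so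
          -- the expected number of survivors is at most `c` times the cardinality of `U`.
          have : ∀ ω : Innovation n m, ((U.erase ω.2.2.1).card : ℝ≥0∞) =
              ∑ u ∈ U, {ω : Innovation n m | ω.2.2.1 ≠ u}.indicator 1 ω := by
            intro ω
            simp only [Set.indicator_apply, Set.mem_ofPred_eq, Pi.one_apply, Finset.sum_ite,
              Finset.sum_const_zero, add_zero, Finset.sum_const, nsmul_eq_mul, mul_one]
            congr 2
            ext u
            simp [and_comm, eq_comm]
          simp_rw [this]
          rw [lintegral_mul_const _ (Finset.measurable_sum _ fun u _ =>
            measurable_one.indicator (hD u)), lintegral_finsetSum _ fun u _ =>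
            measurable_one.indicator (hD u), pow_succ, mul_comm (c ^ t), ← mul_assoc]
          gcongr
          simp_rw [lintegral_indicator_one (hD _)]
          refine (Finset.sum_le_sum fun u _ => hc u).trans ?_
          simp

/-! ### Existence and uniqueness of the stationary law -/

instance (m : ℕ) : IsProbabilityMeasure (volume : Measure (Torus m)) := by
  refine ⟨?_⟩
  rw [volume_pi, Measure.pi_univ]
  simp

theorem isProbabilityMeasure_uniformOn_fin (hn : 1 ≤ n) :
    IsProbabilityMeasure (uniformOn (Set.univ : Set (Fin n))) :=
  have : Nonempty (Fin n) := ⟨⟨0, hn⟩⟩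
  isProbabilityMeasure_uniformOn Set.finite_univ Set.univ_nonempty

theorem uniformOn_univ_ne (hn : 1 ≤ n) (u : Fin n) :
    uniformOn (Set.univ : Set (Fin n)) {d | d ≠ u} = ENNReal.ofReal (1 - 1 / n) := by
  have := isProbabilityMeasure_uniformOn_fin hn
  have h1 : uniformOn (Set.univ : Set (Fin n)) {u} = 1 / n := by
    rw [uniformOn_univ]; simp
  have : {d | d ≠ u} = ({u} : Set (Fin n))ᶜ := rfl
  rw [this, prob_compl_eq_one_sub (measurableSet_singleton u), h1, ENNReal.ofReal_sub _ (by positivity),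
    ENNReal.ofReal_div_of_pos (by exact_mod_cast hn)]
  simp

theorem measurePreserving_deleted (hn : 1 ≤ n) (p : unitInterval) (ν : Measure (Fin n))
    [IsProbabilityMeasure ν] :
    MeasurePreserving (fun ω : Innovation n m => ω.2.2.1) (innovationLaw m p ν)
      (uniformOn Set.univ) := by
  have := isProbabilityMeasure_uniformOn_fin hn
  exact measurePreserving_fst.comp (measurePreserving_snd.comp measurePreserving_snd)

theorem innovationLaw_deleted_ne (hn : 1 ≤ n) (p : unitInterval) (ν : Measure (Fin n))
    [IsProbabilityMeasure ν] (u : Fin n) :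
    innovationLaw m p ν {ω | ω.2.2.1 ≠ u} = ENNReal.ofReal (1 - 1 / n) := by
  rw [← uniformOn_univ_ne hn u, ← (measurePreserving_deleted (m := m) hn p ν).measure_preimage
    (MeasurableSet.of_discrete).nullMeasurableSet]
  rfl

theorem isMarkovKernel_transition (hn : 1 ≤ n) (p : unitInterval) (ν : Measure (Fin n))
    [IsProbabilityMeasure ν] : IsMarkovKernel (transition m α β p ν) := by
  have := isProbabilityMeasure_innovationLaw hn m p ν
  refine ⟨fun s => ?_⟩
  rw [transition_apply hn]
  exact Measure.isProbabilityMeasure_map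
    ((measurable_step α β).comp measurable_prodMk_left).aemeasurable

theorem lintegral_bind_transition (hn : 1 ≤ n) (p : unitInterval) (ν : Measure (Fin n))
    [IsProbabilityMeasure ν] (μ : Measure (State n m)) {f : State n m → ℝ≥0∞} (hf : Measurable f) :
    ∫⁻ s, f s ∂(μ.bind (transition m α β p ν)) =
      ∫⁻ s, stepMean α β (innovationLaw m p ν) f s ∂μ := by
  rw [Measure.lintegral_bind (Kernel.aemeasurable _) hf.aemeasurable]
  refine lintegral_congr fun s => ?_
  rw [transition_apply hn, lintegral_map hf]
  · rfl
  · exact (measurable_step α β).comp measurable_prodMk_left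

/-- The law after `t` steps of the chain with initial law `μ`. -/
def lawAfter (m : ℕ) (α β : ℝ) (p : unitInterval) (ν : Measure (Fin n)) (t : ℕ)
    (μ : Measure (State n m)) : Measure (State n m) :=
  (fun ξ : Measure (State n m) => ξ.bind (transition m α β p ν))^[t] μ

theorem isProbabilityMeasure_lawAfter (hn : 1 ≤ n) (p : unitInterval) (ν : Measure (Fin n))
    [IsProbabilityMeasure ν] (t : ℕ) (μ : Measure (State n m)) [IsProbabilityMeasure μ] :
    IsProbabilityMeasure (lawAfter m α β p ν t μ) := by
  have := isMarkovKernel_transition (m := m) (α := α) (β := β) hn p ν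
  induction t with
  | zero => assumption
  | succ t ih =>
    rw [lawAfter, Function.iterate_succ_apply']
    change IsProbabilityMeasure ((lawAfter m α β p ν t μ).bind _)
    infer_instance

theorem lintegral_lawAfter (hn : 1 ≤ n) (p : unitInterval) (ν : Measure (Fin n))
    [IsProbabilityMeasure ν] (t : ℕ) (μ : Measure (State n m)) {f : State n m → ℝ≥0∞}
    (hf : Measurable f) :
    ∫⁻ s, f s ∂(lawAfter m α β p ν t μ) =
      ∫⁻ s, (stepMean α β (innovationLaw m p ν))^[t] f s ∂μ := by
  have := isProbabilityMeasure_innovationLaw hn m p ν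
  induction t generalizing μ with
  | zero => rfl
  | succ t ih =>
    rw [lawAfter, Function.iterate_succ_apply]
    refine (ih _).trans ?_
    rw [lintegral_bind_transition hn p ν μ (measurable_stepMean_iterate hf t)]
    simp only [Function.iterate_succ_apply']

/-- The rate of convergence of the chain. -/
def mixingRate (n t : ℕ) : ℝ := n * (1 - 1 / n) ^ t

theorem mixingRate_nonneg (n t : ℕ) : 0 ≤ mixingRate n t := by
  have : (1 : ℝ) / n ≤ 1 := by
    rcases Nat.eq_zero_or_pos n with rfl | h
    · simp
    · rw [div_le_one (by positivity)]; exact_mod_cast h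
  exact mul_nonneg (by positivity) (pow_nonneg (by linarith) _)

theorem tendsto_mixingRate (hn : 1 ≤ n) : Tendsto (mixingRate n) atTop (𝓝 0) := by
  have h1 : (1 : ℝ) / n ≤ 1 := by
    rw [div_le_one (by positivity)]; exact_mod_cast hn
  have h0 : (0 : ℝ) < 1 / n := by positivity
  have h := (tendsto_pow_atTop_nhds_zero_of_lt_one (by linarith : (0 : ℝ) ≤ 1 - 1 / n)
    (by linarith)).const_mul (n : ℝ)
  rw [mul_zero] at h
  exact h

/-- Coalescence with `U` the set of all nodes compares any two initial states. The bound is uniform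
in the pair, so it can be averaged over `s'` and then over `s`; no coupling of the initial laws is
required. -/
theorem lintegral_lawAfter_le (hn : 1 ≤ n) (p : unitInterval) (ν : Measure (Fin n))
    [IsProbabilityMeasure ν] (t : ℕ) (μ μ' : Measure (State n m)) [IsProbabilityMeasure μ]
    [IsProbabilityMeasure μ'] {f : State n m → ℝ≥0∞} (hf : Measurable f) (hf1 : ∀ s, f s ≤ 1) :
    ∫⁻ s, f s ∂(lawAfter m α β p ν t μ) ≤
      ∫⁻ s, f s ∂(lawAfter m α β p ν t μ') + ENNReal.ofReal (mixingRate n t) := by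
  have := isProbabilityMeasure_innovationLaw hn m p ν
  have h1 : (1 : ℝ) / n ≤ 1 := by
    rw [div_le_one (by positivity)]; exact_mod_cast hn
  have hr : ENNReal.ofReal (mixingRate n t) = n * ENNReal.ofReal (1 - 1 / n) ^ t := by
    rw [mixingRate, ENNReal.ofReal_mul (by positivity), ENNReal.ofReal_pow (by linarith)]
    simp
  have hpt : ∀ s s' : State n m, (stepMean α β (innovationLaw m p ν))^[t] f s ≤
      (stepMean α β (innovationLaw m p ν))^[t] f s' + ENNReal.ofReal (mixingRate n t) := by
    intro s s'
    have := stepMean_iterate_le (α := α) (β := β)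
      (fun u => (innovationLaw_deleted_ne (m := m) hn p ν u).le) hf hf1 t
      Finset.univ s s' ⟨by simp, by simp⟩
    rwa [Finset.card_univ, Fintype.card_fin, ← hr] at this
  rw [lintegral_lawAfter hn p ν t μ hf, lintegral_lawAfter hn p ν t μ' hf]
  set g := (stepMean α β (innovationLaw m p ν))^[t] f with hg
  have hgm : Measurable g := measurable_stepMean_iterate hf t
  have h2 : ∀ s, g s ≤ ∫⁻ s', g s' ∂μ' + ENNReal.ofReal (mixingRate n t) := by
    intro s
    calc g s = ∫⁻ _, g s ∂μ' := by simp
      _ ≤ ∫⁻ s', (g s' + ENNReal.ofReal (mixingRate n t)) ∂μ' := lintegral_mono fun s' => hpt s s'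
      _ = _ := by rw [lintegral_add_left hgm]; simp
  calc ∫⁻ s, g s ∂μ ≤ ∫⁻ _, (∫⁻ s', g s' ∂μ' + ENNReal.ofReal (mixingRate n t)) ∂μ :=
        lintegral_mono h2
    _ = _ := by simp

theorem abs_lawAfter_sub_le (hn : 1 ≤ n) (p : unitInterval) (ν : Measure (Fin n))
    [IsProbabilityMeasure ν] (t : ℕ) (μ μ' : Measure (State n m)) [IsProbabilityMeasure μ]
    [IsProbabilityMeasure μ'] {B : Set (State n m)} (hB : MeasurableSet B) :
    |(lawAfter m α β p ν t μ).real B - (lawAfter m α β p ν t μ').real B| ≤ mixingRate n t := by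
  have key : ∀ (ξ ξ' : Measure (State n m)) [IsProbabilityMeasure ξ] [IsProbabilityMeasure ξ'],
      (lawAfter m α β p ν t ξ).real B ≤ (lawAfter m α β p ν t ξ').real B + mixingRate n t := by
    intro ξ ξ' _ _
    have := isProbabilityMeasure_lawAfter (α := α) (β := β) hn p ν t ξ'
    have h := lintegral_lawAfter_le (α := α) (β := β) hn p ν t ξ ξ'
      (f := B.indicator 1) (measurable_one.indicator hB)
      (fun s => Set.indicator_le_self' (by simp) s)
    rw [lintegral_indicator_one hB, lintegral_indicator_one hB] at h
    have h' := ENNReal.toReal_mono (by finiteness) h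
    rwa [ENNReal.toReal_add (by finiteness) (by finiteness),
      ENNReal.toReal_ofReal (mixingRate_nonneg n t)] at h'
  rw [abs_sub_le_iff]
  constructor <;> linarith [key μ μ', key μ' μ]

theorem IsGeoP.lawAfter_eq {p : unitInterval} {ν : Measure (Fin n)} {π : Measure (State n m)}
    (h : IsGeoP α β p ν π) (t : ℕ) : lawAfter m α β p ν t π = π := by
  induction t with
  | zero => rfl
  | succ t ih => 
    rw [lawAfter, Function.iterate_succ_apply']
    change (lawAfter m α β p ν t π).bind _ = π
    rw [ih]
    exact h.invariant

theorem IsGeoP.abs_lawAfter_sub_le (hn : 1 ≤ n) {p : unitInterval} {ν : Measure (Fin n)}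
    [IsProbabilityMeasure ν] {π : Measure (State n m)} (h : IsGeoP α β p ν π) (t : ℕ)
    (μ : Measure (State n m)) [IsProbabilityMeasure μ] {B : Set (State n m)}
    (hB : MeasurableSet B) :
    |(lawAfter m α β p ν t μ).real B - π.real B| ≤ mixingRate n t := by
  have := h.isProbabilityMeasure
  have := GeoP.abs_lawAfter_sub_le (α := α) (β := β) hn p ν t μ π hB
  rwa [h.lawAfter_eq] at this

theorem IsGeoP.tendsto_lawAfter (hn : 1 ≤ n) {p : unitInterval} {ν : Measure (Fin n)}
    [IsProbabilityMeasure ν] {π : Measure (State n m)} (h : IsGeoP α β p ν π)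
    (μ : Measure (State n m)) [IsProbabilityMeasure μ] {B : Set (State n m)}
    (hB : MeasurableSet B) :
    Tendsto (fun t => (lawAfter m α β p ν t μ).real B) atTop (𝓝 (π.real B)) := by
  rw [tendsto_iff_dist_tendsto_zero]
  refine squeeze_zero (fun t => dist_nonneg) (fun t => ?_) (tendsto_mixingRate hn)
  exact h.abs_lawAfter_sub_le hn t μ hB

/-- The law with independent uniform positions and no edges. -/
def emptyLaw (n m : ℕ) : Measure (State n m) :=
  (Measure.pi fun _ : Fin n => (volume : Measure (Torus m))).prod (Measure.dirac ⊥)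

instance : IsProbabilityMeasure (emptyLaw n m) := by unfold emptyLaw; infer_instance

theorem IsGeoP.eq (hn : 1 ≤ n) {p : unitInterval} {ν : Measure (Fin n)}
    [IsProbabilityMeasure ν] {π π' : Measure (State n m)} (h : IsGeoP α β p ν π)
    (h' : IsGeoP α β p ν π') : π = π' := by
  have := h.isProbabilityMeasure
  have := h'.isProbabilityMeasure
  ext B hB
  rw [← measureReal_eq_measureReal_iff]
  exact tendsto_nhds_unique (h.tendsto_lawAfter hn (emptyLaw n m) hB)
    (h'.tendsto_lawAfter hn (emptyLaw n m) hB)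

/-- The law after `t'` steps is the law after `t` steps from another initial law, so contraction
makes the sequence uniformly Cauchy on sets. Its limit is invariant because the image of the limit
under the kernel is a limit of the shifted sequence. -/
theorem exists_isGeoP (hn : 1 ≤ n) (p : unitInterval) (ν : Measure (Fin n))
    [IsProbabilityMeasure ν] : ∃ π : Measure (State n m), IsGeoP α β p ν π := by
  have := isMarkovKernel_transition (m := m) (α := α) (β := β) hn p ν
  have hprob := fun t => isProbabilityMeasure_lawAfter (α := α) (β := β) hn p ν t (emptyLaw n m)
  have hcauchy : ∀ t t', t ≤ t' → ∀ B : Set (State n m), MeasurableSet B →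
      |(lawAfter m α β p ν t (emptyLaw n m)).real B -
        (lawAfter m α β p ν t' (emptyLaw n m)).real B| ≤ mixingRate n t := by
    intro t t' htt' B hB
    have h1 : lawAfter m α β p ν t' (emptyLaw n m) =
        lawAfter m α β p ν t (lawAfter m α β p ν (t' - t) (emptyLaw n m)) := by
      rw [lawAfter, lawAfter, lawAfter, ← Function.iterate_add_apply]
      congr 2; omega
    rw [h1]
    exact abs_lawAfter_sub_le hn p ν t _ _ hB
  obtain ⟨π, hπ, hlim⟩ := exists_setwise_limit (fun t => lawAfter m α β p ν t (emptyLaw n m))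
    (mixingRate n) (tendsto_mixingRate hn) hcauchy
  -- A Markov kernel does not increase the setwise distance: the probability of `B` after one step
  -- is a function with values in [0, 1].
  have hbind : ∀ t (B : Set (State n m)), MeasurableSet B →
      |(lawAfter m α β p ν (t + 1) (emptyLaw n m)).real B -
        (π.bind (transition m α β p ν)).real B| ≤ mixingRate n t := by
    intro t B hB
    have hle : ∀ B : Set (State n m), MeasurableSet B →
        lawAfter m α β p ν t (emptyLaw n m) B ≤ π B + ENNReal.ofReal (mixingRate n t) ∧
        π B ≤ lawAfter m α β p ν t (emptyLaw n m) B + ENNReal.ofReal (mixingRate n t) := by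
      intro B hB
      have h := abs_le.1 (hlim t B hB)
      rw [← ofReal_measureReal (measure_ne_top π B),
        ← ofReal_measureReal (measure_ne_top (lawAfter m α β p ν t (emptyLaw n m)) B),
        ← ENNReal.ofReal_add measureReal_nonneg (mixingRate_nonneg n t),
        ← ENNReal.ofReal_add measureReal_nonneg (mixingRate_nonneg n t)]
      exact ⟨ENNReal.ofReal_le_ofReal (by linarith [h.2]), ENNReal.ofReal_le_ofReal (by linarith [h.1])⟩
    have hg : Measurable fun s => transition m α β p ν s B := Kernel.measurable_coe _ hB
    have hg1 : ∀ s, transition m α β p ν s B ≤ 1 := fun s => prob_le_one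
    have h1 := lintegral_le_add_of_forall_measure_le (fun B hB => (hle B hB).1) hg hg1
    have h2 := lintegral_le_add_of_forall_measure_le (fun B hB => (hle B hB).2) hg hg1
    rw [← Measure.bind_apply hB (Kernel.aemeasurable _),
      ← Measure.bind_apply hB (Kernel.aemeasurable _)] at h1 h2
    have hs : lawAfter m α β p ν (t + 1) (emptyLaw n m) =
        (lawAfter m α β p ν t (emptyLaw n m)).bind (transition m α β p ν) := by
      rw [lawAfter, Function.iterate_succ_apply']; rfl
    rw [hs]
    have h1' := ENNReal.toReal_mono (by finiteness) h1
    have h2' := ENNReal.toReal_mono (by finiteness) h2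
    rw [ENNReal.toReal_add (by finiteness) (by finiteness),
      ENNReal.toReal_ofReal (mixingRate_nonneg n t)] at h1' h2'
    rw [abs_sub_le_iff]
    simp only [measureReal_def]
    constructor <;> linarith
  refine ⟨π, hπ, ?_⟩
  refine Measure.ext fun B hB => ?_
  rw [← measureReal_eq_measureReal_iff]
  refine tendsto_nhds_unique (f := fun t => (lawAfter m α β p ν (t + 1) (emptyLaw n m)).real B) ?_ ?_
    (l := atTop)
  · rw [tendsto_iff_dist_tendsto_zero]
    exact squeeze_zero (fun t => dist_nonneg) (fun t => hbind t B hB) (tendsto_mixingRate hn)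
  · rw [tendsto_iff_dist_tendsto_zero]
    exact squeeze_zero (fun t => dist_nonneg) (fun t => hlim (t + 1) B hB)
      ((tendsto_mixingRate hn).comp (tendsto_add_atTop_nat 1))

/-! ### Uniformity of the stationary positions -/

/-- The law of `n` independent uniform positions. -/
abbrev uniformPositions (n m : ℕ) : Measure (Fin n → Torus m) :=
  Measure.pi fun _ : Fin n => (volume : Measure (Torus m))

theorem measurable_step_right (s : State n m) : Measurable (step α β s) :=
  (measurable_step α β).comp measurable_prodMk_left

/-- For fixed `D` and `R` a step permutes the coordinates and overwrites one of them, so boxes pull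
back to boxes in which the coordinate `D` is unconstrained. -/
theorem step_mem_box_iff (s : State n m) (ω : Innovation n m) (t : Fin n → Set (Torus m)) :
    (step α β s ω).1 ∈ Set.univ.pi t ↔
      ω.1 ∈ t ω.2.2.2 ∧
        s.1 ∈ Set.univ.pi
          (Function.update (fun j => t (rankPerm ω.2.2.1 ω.2.2.2 j)) ω.2.2.1 Set.univ) := by
  simp only [step, Set.mem_univ_pi]
  constructor
  · intro h
    constructor
    · have := h (rankPerm ω.2.2.1 ω.2.2.2 ω.2.2.1)
      rwa [Equiv.symm_apply_apply, Function.update_self, rankPerm_deleted] at this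
    · intro j
      by_cases hj : j = ω.2.2.1
      · subst hj; simp
      · have := h (rankPerm ω.2.2.1 ω.2.2.2 j)
        simpa [hj] using this
  · rintro ⟨hy, hs⟩ k
    obtain ⟨j, rfl⟩ := (rankPerm ω.2.2.1 ω.2.2.2).surjective k
    by_cases hj : j = ω.2.2.1
    · rw [hj, Equiv.symm_apply_apply, Function.update_self, rankPerm_deleted]
      exact hy
    · have := hs j
      simpa [hj] using this

/-- Deletion, initial rank and the new position are independent of the old positions. Replacing one
coordinate of a product of uniform laws by a fresh uniform one and permuting the coordinates leaves
the product unchanged. It suffices to test boxes. -/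
theorem map_fst_bind_transition (hn : 1 ≤ n) (p : unitInterval) (ν : Measure (Fin n))
    [IsProbabilityMeasure ν] (μ : Measure (State n m)) [IsProbabilityMeasure μ]
    (hμ : μ.map Prod.fst = uniformPositions n m) :
    (μ.bind (transition m α β p ν)).map Prod.fst = uniformPositions n m := by
  have := isProbabilityMeasure_innovationLaw hn m p ν
  have := isProbabilityMeasure_uniformOn_fin hn
  refine (Measure.pi_eq fun t ht => ?_).symm
  have hbox : MeasurableSet (Set.univ.pi t) := MeasurableSet.univ_pi ht
  have hpre : MeasurableSet (Prod.fst ⁻¹' (Set.univ.pi t) : Set (State n m)) :=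
    measurable_fst hbox
  have hind : Measurable ((Prod.fst ⁻¹' (Set.univ.pi t) : Set (State n m)).indicator
      (1 : State n m → ℝ≥0∞)) := measurable_one.indicator hpre
  rw [Measure.map_apply measurable_fst hbox, ← lintegral_indicator_one hpre,
    lintegral_bind_transition hn p ν μ hind]
  simp only [stepMean]
  rw [lintegral_lintegral_swap (f := fun s ω =>
    (Prod.fst ⁻¹' Set.univ.pi t : Set (State n m)).indicator 1 (step α β s ω)) (hind.comp (measurable_step α β)).aemeasurable]
  -- `rankPerm` maps the indices other than `D` bijectively onto those other than `R`, so after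
  -- integration over the old positions the deleted rank has dropped out.
  have hinner : ∀ ω : Innovation n m,
      ∫⁻ s, (Prod.fst ⁻¹' (Set.univ.pi t) : Set (State n m)).indicator 1 (step α β s ω) ∂μ =
        (t ω.2.2.2).indicator 1 ω.1 * ∏ k ∈ Finset.univ.erase ω.2.2.2, volume (t k) := by
    intro ω
    set b := Set.univ.pi
      (Function.update (fun j => t (rankPerm ω.2.2.1 ω.2.2.2 j)) ω.2.2.1 Set.univ) with hb
    have hbm : MeasurableSet b := by
      refine MeasurableSet.univ_pi fun j => ?_
      by_cases hj : j = ω.2.2.1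
      · subst hj; simp
      · simpa [hj] using ht _
    have h1 : ∀ s : State n m,
        (Prod.fst ⁻¹' (Set.univ.pi t) : Set (State n m)).indicator (1 : State n m → ℝ≥0∞)
          (step α β s ω) =
        (t ω.2.2.2).indicator 1 ω.1 * (Prod.fst ⁻¹' b : Set (State n m)).indicator 1 s := by
      intro s
      have := step_mem_box_iff (α := α) (β := β) s ω t
      rw [← hb] at this
      by_cases h1 : ω.1 ∈ t ω.2.2.2
      · by_cases h2 : s.1 ∈ b
        · rw [Set.indicator_of_mem (show s ∈ Prod.fst ⁻¹' b from h2), Set.indicator_of_mem h1,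
            Set.indicator_of_mem (Set.mem_preimage.2 (this.2 ⟨h1, h2⟩))]
          simp
        · rw [Set.indicator_of_notMem (show s ∉ Prod.fst ⁻¹' b from h2), mul_zero,
            Set.indicator_of_notMem (show step α β s ω ∉ Prod.fst ⁻¹' Set.univ.pi t from
              fun h => h2 (this.1 h).2)]
      · rw [Set.indicator_of_notMem h1, zero_mul,
          Set.indicator_of_notMem (show step α β s ω ∉ Prod.fst ⁻¹' Set.univ.pi t from
            fun h => h1 (this.1 h).1)]
    simp_rw [h1]
    rw [lintegral_const_mul _ (measurable_one.indicator (measurable_fst hbm)),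
      lintegral_indicator_one (measurable_fst hbm), ← Measure.map_apply measurable_fst hbm, hμ,
      Measure.pi_pi]
    congr 1
    rw [← Finset.mul_prod_erase _ _ (Finset.mem_univ ω.2.2.1)]
    simp only [Function.update_self, measure_univ, one_mul]
    refine Finset.prod_bij (fun j _ => rankPerm ω.2.2.1 ω.2.2.2 j) ?_ ?_ ?_ ?_
    · intro j hj
      simp only [Finset.mem_erase, Finset.mem_univ, and_true] at hj ⊢
      intro h
      exact hj ((rankPerm ω.2.2.1 ω.2.2.2).injective (h.trans (rankPerm_deleted _ _).symm))
    · intro i _ j _ h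
      exact (rankPerm ω.2.2.1 ω.2.2.2).injective h
    · intro k hk
      obtain ⟨j, rfl⟩ := (rankPerm ω.2.2.1 ω.2.2.2).surjective k
      refine ⟨j, ?_, rfl⟩
      simp only [Finset.mem_erase, Finset.mem_univ, and_true] at hk ⊢
      rintro rfl
      exact hk (rankPerm_deleted _ _)
    · intro j hj
      rw [Function.update_of_ne (Finset.ne_of_mem_erase hj)]
  simp_rw [hinner]
  have hmp : MeasurePreserving (fun ω : Innovation n m => (ω.1, ω.2.2.2)) (innovationLaw m p ν)
      ((volume : Measure (Torus m)).prod ν) :=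
    (MeasurePreserving.id _).prod (measurePreserving_snd.comp measurePreserving_snd)
  have hg : Measurable fun q : Torus m × Fin n =>
      ((t q.2).indicator 1 q.1 * ∏ k ∈ Finset.univ.erase q.2, volume (t k) : ℝ≥0∞) := by
    refine measurable_from_prod_countable_left fun R => ?_
    exact (measurable_one.indicator (ht R)).mul_const (∏ k ∈ Finset.univ.erase R, volume (t k))
  rw [hmp.lintegral_comp hg, lintegral_prod_symm _ hg.aemeasurable]
  have h2 : ∀ R, ∫⁻ y, ((t R).indicator 1 y *
      ∏ k ∈ Finset.univ.erase R, volume (t k)) ∂(volume : Measure (Torus m)) =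
        ∏ k, volume (t k) := by
    intro R
    rw [lintegral_mul_const _ (measurable_one.indicator (ht R)), lintegral_indicator_one (ht R),
      Finset.mul_prod_erase _ (fun k => volume (t k)) (Finset.mem_univ R)]
  simp_rw [h2]
  simp

/-- In the stationary state the positions are independent and uniform. -/
theorem IsGeoP.map_fst (hn : 1 ≤ n) {p : unitInterval} {ν : Measure (Fin n)}
    [IsProbabilityMeasure ν] {π : Measure (State n m)} (h : IsGeoP α β p ν π) :
    π.map Prod.fst = uniformPositions n m := by
  have := h.isProbabilityMeasure
  -- Started from `emptyLaw`, the positions are uniform at all times, and setwise convergence passes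
  -- this on to `π`.
  have hlaw : ∀ t, (lawAfter m α β p ν t (emptyLaw n m)).map Prod.fst =
      uniformPositions n m := by
    intro t
    induction t with
    | zero => simp [lawAfter, emptyLaw]
    | succ t ih =>
      have := isProbabilityMeasure_lawAfter (α := α) (β := β) hn p ν t (emptyLaw n m)
      rw [lawAfter, Function.iterate_succ_apply']
      change ((lawAfter m α β p ν t (emptyLaw n m)).bind _).map _ = _
      exact map_fst_bind_transition hn p ν _ ih
  have := Measure.isProbabilityMeasure_map (μ := π) (measurable_fst.aemeasurable)
  refine Measure.ext fun B hB => ?_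
  rw [← measureReal_eq_measureReal_iff]
  refine tendsto_nhds_unique ?_ (tendsto_const_nhds (x := (uniformPositions n m).real B)
    (f := (atTop : Filter ℕ)))
  have h1 := h.tendsto_lawAfter hn (emptyLaw n m) (measurable_fst hB)
  rw [← map_measureReal_apply measurable_fst hB] at h1
  refine h1.congr fun t => ?_
  rw [← map_measureReal_apply measurable_fst hB, hlaw]

/-- A time-step from a stationary state leads to a stationary state. -/
theorem IsGeoP.measurePreserving_step (hn : 1 ≤ n) {p : unitInterval} {ν : Measure (Fin n)}
    [IsProbabilityMeasure ν] {π : Measure (State n m)} (h : IsGeoP α β p ν π) :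
    MeasurePreserving (fun q : State n m × Innovation n m => step α β q.1 q.2)
      (π.prod (innovationLaw m p ν)) π := by
  have := h.isProbabilityMeasure
  have := isProbabilityMeasure_innovationLaw hn m p ν
  refine ⟨measurable_step α β, ?_⟩
  refine Measure.ext fun B hB => ?_
  conv_rhs => rw [← h.invariant, Measure.bind_apply hB (Kernel.aemeasurable _)]
  rw [Measure.map_apply (measurable_step α β) hB,
    Measure.prod_apply (measurable_step α β hB)]
  refine lintegral_congr fun s => ?_
  rw [transition_apply hn, Measure.map_apply (measurable_step_right s) hB]
  rfl

/-! ### Degrees and edges in one step -/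

open Classical in
/-- The entries of the adjacency matrix. -/
def adjInd (G : SimpleGraph (Fin n)) (i j : Fin n) : ℝ := if G.Adj i j then 1 else 0

/-- The degree of a node. -/
def deg (G : SimpleGraph (Fin n)) (k : Fin n) : ℝ := ∑ j, adjInd G k j

open Classical in
/-- The indicator that the new node falls in the influence region of `b` and that the coin of `b`
shows `true`. -/
def hit (α β : ℝ) (s : State n m) (ω : Innovation n m) (b : Fin n) : ℝ :=
  if ω.2.1 b = true ∧ ω.1 ∈ influenceRegion α β (s.1 b) b then 1 else 0

/-- The degree of the new node. -/
def newDeg (α β : ℝ) (s : State n m) (ω : Innovation n m) : ℝ :=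
  ∑ b ∈ Finset.univ.erase ω.2.2.1, hit α β s ω b

theorem adjInd_congr {G H : SimpleGraph (Fin n)} {i j k l : Fin n} (h : G.Adj i j ↔ H.Adj k l) :
    adjInd G i j = adjInd H k l := by
  classical
  exact if_congr h rfl rfl

theorem adjInd_nonneg (G : SimpleGraph (Fin n)) (i j : Fin n) : 0 ≤ adjInd G i j := by
  unfold adjInd; split_ifs <;> norm_num

theorem adjInd_le_one (G : SimpleGraph (Fin n)) (i j : Fin n) : adjInd G i j ≤ 1 := by
  unfold adjInd; split_ifs <;> norm_num

theorem adjInd_comm (G : SimpleGraph (Fin n)) (i j : Fin n) : adjInd G i j = adjInd G j i :=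
  adjInd_congr (G.adj_comm i j)

theorem adjInd_self (G : SimpleGraph (Fin n)) (i : Fin n) : adjInd G i i = 0 := by
  simp [adjInd]

theorem hit_nonneg (s : State n m) (ω : Innovation n m) (b : Fin n) : 0 ≤ hit α β s ω b := by
  unfold hit; split_ifs <;> norm_num

theorem hit_le_one (s : State n m) (ω : Innovation n m) (b : Fin n) : hit α β s ω b ≤ 1 := by
  unfold hit; split_ifs <;> norm_num

theorem deg_nonneg (G : SimpleGraph (Fin n)) (k : Fin n) : 0 ≤ deg G k :=
  Finset.sum_nonneg fun _ _ => adjInd_nonneg _ _ _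

theorem deg_le (G : SimpleGraph (Fin n)) (k : Fin n) : deg G k ≤ n := by
  refine (Finset.sum_le_sum fun j _ => adjInd_le_one G k j).trans ?_
  simp

theorem newDeg_nonneg (s : State n m) (ω : Innovation n m) : 0 ≤ newDeg α β s ω :=
  Finset.sum_nonneg fun _ _ => hit_nonneg _ _ _

theorem newDeg_le_sum (s : State n m) (ω : Innovation n m) :
    newDeg α β s ω ≤ ∑ b, hit α β s ω b :=
  Finset.sum_le_sum_of_subset_of_nonneg (Finset.erase_subset _ _) fun _ _ _ => hit_nonneg _ _ _

theorem newDeg_le (s : State n m) (ω : Innovation n m) : newDeg α β s ω ≤ n := by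
  refine (newDeg_le_sum s ω).trans ((Finset.sum_le_sum fun j _ => hit_le_one s ω j).trans ?_)
  simp

theorem sum_deg (G : SimpleGraph (Fin n)) : ∑ k, deg G k = 2 * numEdges G := by
  classical
  have h1 : ∀ k, deg G k = (G.degree k : ℝ) := by
    intro k
    rw [← SimpleGraph.card_neighborFinset_eq_degree, SimpleGraph.neighborFinset_eq_filter]
    simp [deg, adjInd]
  have h2 : numEdges G = (G.edgeFinset.card : ℝ) := by
    rw [numEdges, ← SimpleGraph.coe_edgeFinset, Set.ncard_coe_finset]
  simp_rw [h1]
  rw [h2]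
  exact_mod_cast G.sum_degrees_eq_twice_card_edges

theorem numEdges_nonneg (G : SimpleGraph (Fin n)) : 0 ≤ numEdges G := by
  unfold numEdges; positivity

theorem numEdges_le (G : SimpleGraph (Fin n)) : numEdges G ≤ (n : ℝ) ^ 2 := by
  have h := sum_deg G
  have h2 : ∑ k, deg G k ≤ (n : ℝ) ^ 2 := by
    refine (Finset.sum_le_sum fun k _ => deg_le G k).trans ?_
    simp [sq]
  linarith [numEdges_nonneg G]

theorem adjInd_step (s : State n m) (ω : Innovation n m) (i j : Fin n) :
    adjInd (step α β s ω).2 (rankPerm ω.2.2.1 ω.2.2.2 i) (rankPerm ω.2.2.1 ω.2.2.2 j) =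
      adjInd (stepGraph α β s ω) i j :=
  adjInd_congr (by simp [step])

theorem deg_step (s : State n m) (ω : Innovation n m) (i : Fin n) :
    deg (step α β s ω).2 (rankPerm ω.2.2.1 ω.2.2.2 i) = deg (stepGraph α β s ω) i := by
  rw [deg, ← Equiv.sum_comp (rankPerm ω.2.2.1 ω.2.2.2)]
  simp_rw [adjInd_step]
  rfl

theorem adjInd_stepGraph_deleted (s : State n m) (ω : Innovation n m) {j : Fin n}
    (hj : j ≠ ω.2.2.1) : adjInd (stepGraph α β s ω) ω.2.2.1 j = hit α β s ω j := by
  classical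
  refine if_congr ?_ rfl rfl
  simp [stepGraph, hj, hj.symm]

theorem adjInd_stepGraph_of_ne (s : State n m) (ω : Innovation n m) {i j : Fin n}
    (hi : i ≠ ω.2.2.1) (hj : j ≠ ω.2.2.1) :
    adjInd (stepGraph α β s ω) i j = adjInd s.2 i j := by
  have : (stepGraph α β s ω).Adj i j ↔ s.2.Adj i j := by
    simp only [stepGraph, SimpleGraph.fromRel_adj]
    simp only [ne_eq, hi, hj, not_false_eq_true, true_and, false_and, or_false, s.2.adj_comm j i,
      or_self]
    exact ⟨fun h => h.2, fun h => ⟨h.ne, h⟩⟩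
  exact adjInd_congr this

theorem deg_stepGraph_deleted (s : State n m) (ω : Innovation n m) :
    deg (stepGraph α β s ω) ω.2.2.1 = newDeg α β s ω := by
  rw [deg, ← Finset.add_sum_erase _ _ (Finset.mem_univ ω.2.2.1), adjInd_self, zero_add, newDeg]
  exact Finset.sum_congr rfl fun j hj => adjInd_stepGraph_deleted s ω (Finset.ne_of_mem_erase hj)

theorem deg_stepGraph_of_ne (s : State n m) (ω : Innovation n m) {i : Fin n}
    (hi : i ≠ ω.2.2.1) :
    deg (stepGraph α β s ω) i = deg s.2 i - adjInd s.2 ω.2.2.1 i + hit α β s ω i := by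
  rw [deg, ← Finset.add_sum_erase _ _ (Finset.mem_univ ω.2.2.1), adjInd_comm,
    adjInd_stepGraph_deleted s ω hi, deg, ← Finset.add_sum_erase _ _ (Finset.mem_univ ω.2.2.1),
    adjInd_comm s.2 i, Finset.sum_congr rfl fun j hj =>
      adjInd_stepGraph_of_ne s ω hi (Finset.ne_of_mem_erase hj)]
  ring

theorem deg_step_deleted (s : State n m) (ω : Innovation n m) :
    deg (step α β s ω).2 ω.2.2.2 = newDeg α β s ω := by
  rw [← deg_stepGraph_deleted, ← deg_step, rankPerm_deleted]

/-- Counted through the sum of degrees: each edge lost or gained changes it at the deleted or new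
node and once more at a survivor, whence the factor two on both sides. -/
theorem numEdges_step (s : State n m) (ω : Innovation n m) :
    numEdges (step α β s ω).2 = numEdges s.2 - deg s.2 ω.2.2.1 + newDeg α β s ω := by
  have h : ∑ k, deg (step α β s ω).2 k =
      ∑ k, deg s.2 k - 2 * deg s.2 ω.2.2.1 + 2 * newDeg α β s ω := by
    rw [← Equiv.sum_comp (rankPerm ω.2.2.1 ω.2.2.2)]
    simp_rw [deg_step]
    rw [← Finset.add_sum_erase _ _ (Finset.mem_univ ω.2.2.1), deg_stepGraph_deleted,
      Finset.sum_congr rfl fun j hj => deg_stepGraph_of_ne s ω (Finset.ne_of_mem_erase hj),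
      ← Finset.add_sum_erase _ (fun k => deg s.2 k) (Finset.mem_univ ω.2.2.1),
      Finset.sum_add_distrib, Finset.sum_sub_distrib]
    have h1 : ∑ i ∈ Finset.univ.erase ω.2.2.1, adjInd s.2 ω.2.2.1 i = deg s.2 ω.2.2.1 := by
      rw [deg, ← Finset.add_sum_erase _ _ (Finset.mem_univ ω.2.2.1), adjInd_self, zero_add]
    have h2 : ∑ i ∈ Finset.univ.erase ω.2.2.1, hit α β s ω i = newDeg α β s ω := rfl
    rw [h1, h2]
    ring
  rw [sum_deg, sum_deg] at h
  linarith

/-! ### Conditional means in one step -/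

/-- The volume of the influence region of the node of rank `r`. -/
def regionVolume (n : ℕ) (α β : ℝ) (r : Fin n) : ℝ := (rank r) ^ (-α) * (n : ℝ) ^ (-β)

theorem regionVolume_nonneg (r : Fin n) : 0 ≤ regionVolume n α β r := by
  have := one_le_rank r
  unfold regionVolume; positivity

theorem regionVolume_le (hα : 0 ≤ α) (r : Fin n) : regionVolume n α β r ≤ (n : ℝ) ^ (-β) := by
  refine mul_le_of_le_one_left (by positivity) ?_
  exact Real.rpow_le_one_of_one_le_of_nonpos (one_le_rank r) (by linarith)

theorem volume_real_influenceRegion (hm : 1 ≤ m) (hα : 0 ≤ α) (hβ : 0 ≤ β)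
    (x : Torus m) (r : Fin n) :
    (volume : Measure (Torus m)).real (influenceRegion α β x r) = regionVolume n α β r := by
  rw [measureReal_def, volume_influenceRegion hm hα hβ, ENNReal.toReal_ofReal]
  · rfl
  · exact regionVolume_nonneg (α := α) (β := β) r

theorem measurable_hit (b : Fin n) :
    Measurable fun q : State n m × Innovation n m => hit α β q.1 q.2 b := by
  unfold hit
  refine Measurable.ite (MeasurableSet.inter ?_ ?_) measurable_const measurable_const
  · exact measurableSet_eq_fun (by fun_prop) (by fun_prop)
  · simp only [influenceRegion]
    exact measurableSet_le (by fun_prop) (by fun_prop)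

theorem measurable_graph_observable (f : SimpleGraph (Fin n) → ℝ) :
    Measurable fun s : State n m => f s.2 := by
  have : DiscreteMeasurableSpace (SimpleGraph (Fin n)) := by
    have : MeasurableSingletonClass (SimpleGraph (Fin n)) := by
      refine ⟨fun G => ?_⟩
      have hG : {G} = ⋂ a, ⋂ b, {H : SimpleGraph (Fin n) | H.Adj a b ↔ G.Adj a b} := by
        ext H
        simp [SimpleGraph.ext_iff, funext_iff]
      rw [hG]
      refine MeasurableSet.iInter fun a => MeasurableSet.iInter fun b => ?_
      exact measurableSet_setOfPred.2 ((SimpleGraph.measurable_iff_adj.1 measurable_id a b).iff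
        measurable_const)
    infer_instance
  exact (Measurable.of_discrete (f := f)).comp measurable_snd

theorem integral_uniformOn_univ (hn : 1 ≤ n) (g : Fin n → ℝ) :
    ∫ d, g d ∂(uniformOn (Set.univ : Set (Fin n))) = (∑ d, g d) / n := by
  have := isProbabilityMeasure_uniformOn_fin hn
  rw [integral_fintype .of_finite, Finset.sum_div]
  refine Finset.sum_congr rfl fun d _ => ?_
  have : (uniformOn (Set.univ : Set (Fin n))).real {d} = 1 / n := by
    rw [measureReal_def, uniformOn_univ]; simp
  rw [this, smul_eq_mul]
  ring

theorem integral_deleted (hn : 1 ≤ n) (p : unitInterval) (ν : Measure (Fin n))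
    [IsProbabilityMeasure ν] (g : Fin n → ℝ) :
    ∫ ω, g ω.2.2.1 ∂(innovationLaw m p ν) = (∑ d, g d) / n := by
  rw [← integral_uniformOn_univ hn g, ← (measurePreserving_deleted (m := m) hn p ν).map_eq,
    integral_map (by fun_prop) (by fun_prop)]

/-- Position, coin and deletion are independent for fixed `s`. Only the volume of the region enters,
so the value does not depend on `s`. -/
theorem integral_mul_hit (hn : 1 ≤ n) (hm : 1 ≤ m) (hα : 0 ≤ α) (hβ : 0 ≤ β) (p : unitInterval)
    (ν : Measure (Fin n)) [IsProbabilityMeasure ν] (g : Fin n → ℝ) (s : State n m) (b : Fin n) :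
    ∫ ω, g ω.2.2.1 * hit α β s ω b ∂(innovationLaw m p ν) =
      (∑ d, g d) / n * (p * regionVolume n α β b) := by
  have := isProbabilityMeasure_uniformOn_fin hn
  have hcoin : (Measure.pi fun _ : Fin n => bernoulliMeasure true false p).real
      {c | c b = true} = p := by
    have h := (measurePreserving_eval (fun _ : Fin n => bernoulliMeasure true false p) b)
    have h2 := h.measureReal_preimage (s := {true}) (MeasurableSet.of_discrete).nullMeasurableSet
    rw [bernoulliMeasure_real_apply _ (MeasurableSet.of_discrete)] at h2
    have h3 : {c : Fin n → Bool | c b = true} = (fun c : Fin n → Bool => c b) ⁻¹' {true} := rfl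
    rw [h3]
    simpa [Function.eval] using h2
  have heq : ∀ ω : Innovation n m, g ω.2.2.1 * hit α β s ω b =
      (influenceRegion α β (s.1 b) b).indicator 1 ω.1 *
        (({c : Fin n → Bool | c b = true}).indicator 1 ω.2.1 * (g ω.2.2.1 * 1)) := by
    intro ω
    by_cases h1 : ω.1 ∈ influenceRegion α β (s.1 b) b <;> by_cases h2 : ω.2.1 b = true <;>
      simp [hit, h1, h2]
  have hreg : MeasurableSet (influenceRegion α β (s.1 b) b) := Metric.isClosed_closedBall.measurableSet
  have hc : MeasurableSet {c : Fin n → Bool | c b = true} :=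
    measurableSet_eq_fun (by fun_prop) (by fun_prop)
  simp_rw [heq]
  rw [innovationLaw, integral_prod_mul (μ := (volume : Measure (Torus m)))
      ((influenceRegion α β (s.1 b) b).indicator 1)
      (fun q : (Fin n → Bool) × Fin n × Fin n =>
        ({c : Fin n → Bool | c b = true}).indicator 1 q.1 * (g q.2.1 * 1)),
    integral_prod_mul (({c : Fin n → Bool | c b = true}).indicator (1 : (Fin n → Bool) → ℝ))
      (fun q : Fin n × Fin n => g q.1 * 1),
    integral_prod_mul g (fun _ : Fin n => (1 : ℝ)), integral_indicator_one hreg,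
    integral_indicator_one hc, hcoin, volume_real_influenceRegion hm hα hβ,
    integral_uniformOn_univ hn]
  simp
  ring

theorem sum_ne_div (hn : 1 ≤ n) (b : Fin n) :
    (∑ d : Fin n, if d ≠ b then (1 : ℝ) else 0) / n = 1 - 1 / n := by
  have hn' : (n : ℝ) ≠ 0 := by positivity
  have : (∑ d : Fin n, if d ≠ b then (1 : ℝ) else 0) = n - 1 := by
    have h : ∀ d : Fin n, (if d ≠ b then (1 : ℝ) else 0) = 1 - if d = b then 1 else 0 := by
      intro d; by_cases hd : d = b <;> simp [hd]
    simp_rw [h]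
    rw [Finset.sum_sub_distrib]
    simp
  rw [this]
  field_simp

theorem measurable_hit_right (s : State n m) (b : Fin n) :
    Measurable fun ω : Innovation n m => hit α β s ω b :=
  (measurable_hit b).comp measurable_prodMk_left

theorem integrable_mul_hit (P : Measure (Innovation n m)) [IsFiniteMeasure P] (g : Fin n → ℝ)
    (s : State n m) (b : Fin n) : Integrable (fun ω => g ω.2.2.1 * hit α β s ω b) P := by
  have hg : Measurable fun ω : Innovation n m => g ω.2.2.1 := by fun_prop
  refine Integrable.of_bound (hg.mul (measurable_hit_right s b)).aestronglyMeasurable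
    (∑ d, |g d|) (Eventually.of_forall fun ω => ?_)
  rw [norm_mul, Real.norm_eq_abs, Real.norm_eq_abs, abs_of_nonneg (hit_nonneg s ω b)]
  refine (mul_le_of_le_one_right (abs_nonneg _) (hit_le_one s ω b)).trans ?_
  exact Finset.single_le_sum (f := fun d => |g d|) (fun d _ => abs_nonneg _) (Finset.mem_univ _)

theorem newDeg_eq_sum (s : State n m) (ω : Innovation n m) :
    newDeg α β s ω = ∑ b, (if ω.2.2.1 ≠ b then 1 else 0) * hit α β s ω b := by
  rw [newDeg, ← Finset.add_sum_erase Finset.univ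
    (fun b => (if ω.2.2.1 ≠ b then 1 else 0) * hit α β s ω b) (Finset.mem_univ ω.2.2.1)]
  simp only [ne_eq, not_true_eq_false, if_false, zero_mul, zero_add]
  refine Finset.sum_congr rfl fun b hb => ?_
  simp [(Finset.ne_of_mem_erase hb).symm]

theorem measurable_newDeg :
    Measurable fun q : State n m × Innovation n m => newDeg α β q.1 q.2 := by
  simp_rw [newDeg_eq_sum]
  refine Finset.measurable_sum _ fun b _ => ?_
  have h : Measurable fun q : State n m × Innovation n m =>
      (if q.2.2.2.1 ≠ b then (1 : ℝ) else 0) :=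
    (Measurable.of_discrete (f := fun d : Fin n => if d ≠ b then (1 : ℝ) else 0)).comp
      (by fun_prop)
  exact h.mul (measurable_hit b)

/-- The mean degree of a new node. -/
def meanNewDeg (n : ℕ) (α β : ℝ) (p : unitInterval) : ℝ :=
  (1 - 1 / n) * (p * ∑ b, regionVolume n α β b)

/-- A node of each rank is present in every state, so the mean is one and the same sum over ranks
for all `s`. This makes the drift of the number of edges linear. The factor 1 - 1/n is the
probability that a given node is not the deleted one. -/
theorem integral_newDeg (hn : 1 ≤ n) (hm : 1 ≤ m) (hα : 0 ≤ α) (hβ : 0 ≤ β) (p : unitInterval)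
    (ν : Measure (Fin n)) [IsProbabilityMeasure ν] (s : State n m) :
    ∫ ω, newDeg α β s ω ∂(innovationLaw m p ν) = meanNewDeg n α β p := by
  have := isProbabilityMeasure_innovationLaw hn m p ν
  simp_rw [newDeg_eq_sum]
  rw [integral_finsetSum _ fun b _ =>
    integrable_mul_hit _ (fun d => if d ≠ b then 1 else 0) s b]
  have h : ∀ b, ∫ ω, (if ω.2.2.1 ≠ b then 1 else 0) * hit α β s ω b ∂(innovationLaw m p ν) =
      (1 - 1 / n) * (p * regionVolume n α β b) := by
    intro b
    rw [integral_mul_hit hn hm hα hβ p ν (fun d => if d ≠ b then 1 else 0) s b, sum_ne_div hn]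
  simp_rw [h]
  rw [meanNewDeg, Finset.mul_sum, Finset.mul_sum]

theorem meanNewDeg_nonneg (hn : 1 ≤ n) (p : unitInterval) : 0 ≤ meanNewDeg n α β p := by
  have h1 : (1 : ℝ) / n ≤ 1 := by
    rw [div_le_one (by positivity)]; exact_mod_cast hn
  exact mul_nonneg (by linarith) (mul_nonneg p.2.1
    (Finset.sum_nonneg fun b _ => regionVolume_nonneg b))

theorem integral_deg_deleted (hn : 1 ≤ n) (p : unitInterval) (ν : Measure (Fin n))
    [IsProbabilityMeasure ν] (s : State n m) :
    ∫ ω, deg s.2 ω.2.2.1 ∂(innovationLaw m p ν) = 2 * numEdges s.2 / n := by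
  rw [integral_deleted hn p ν, sum_deg]

theorem integrable_newDeg (P : Measure (Innovation n m)) [IsFiniteMeasure P] (s : State n m) :
    Integrable (newDeg α β s) P := by
  refine Integrable.of_bound (measurable_newDeg.comp measurable_prodMk_left).aestronglyMeasurable
    n (Eventually.of_forall fun ω => ?_)
  rw [Real.norm_eq_abs]
  exact (abs_of_nonneg (newDeg_nonneg s ω)).trans_le (newDeg_le s ω)

theorem integrable_deg_deleted (P : Measure (Innovation n m)) [IsFiniteMeasure P] (s : State n m) :
    Integrable (fun ω => deg s.2 ω.2.2.1) P := by
  refine Integrable.of_bound (by fun_prop) n (Eventually.of_forall fun ω => ?_)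
  rw [Real.norm_eq_abs]
  exact (abs_of_nonneg (deg_nonneg _ _)).trans_le (deg_le _ _)

/-! ### Exponential moments of the degrees -/

/-- For independent uniform positions, the exponential moments of the number of influence regions
that contain a uniform point are those of a sum of independent indicators. -/
theorem integral_exp_sum_hit_le (hn : 1 ≤ n) (hm : 1 ≤ m) (hα : 0 ≤ α) (hβ : 0 ≤ β)
    {p : unitInterval} {ν : Measure (Fin n)} [IsProbabilityMeasure ν] {π : Measure (State n m)}
    (h : IsGeoP α β p ν π) {θ : ℝ} (hθ : 0 ≤ θ) :
    ∫ q, Real.exp (θ * ∑ b, hit α β q.1 q.2 b) ∂(π.prod (innovationLaw m p ν)) ≤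
      ∏ b, (1 + (Real.exp θ - 1) * regionVolume n α β b) := by
  have := h.isProbabilityMeasure
  have := isProbabilityMeasure_innovationLaw hn m p ν
  have hc : 0 ≤ Real.exp θ - 1 := by linarith [Real.one_le_exp hθ]
  -- By symmetry of the distance, the new point `y` lies in the region of `b` iff the position of
  -- `b` lies in the same ball around `y`. For fixed `y` these events are independent. Coins are
  -- bounded by one, and `φ` equals exp θ on the event and 1 off it.
  let φ : Torus m → Fin n → Torus m → ℝ := fun y b x =>
    1 + (Real.exp θ - 1) * (influenceRegion α β y b).indicator 1 x
  have hφ0 : ∀ y b x, 0 ≤ φ y b x := fun y b x => by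
    have : 0 ≤ (influenceRegion α β y b).indicator (1 : Torus m → ℝ) x :=
      Set.indicator_nonneg (fun _ _ => zero_le_one) _
    positivity
  have hφ1 : ∀ y b x, φ y b x ≤ Real.exp θ := fun y b x => by
    have : (influenceRegion α β y b).indicator (1 : Torus m → ℝ) x ≤ 1 :=
      Set.indicator_le_self' (fun _ _ => zero_le_one) _
    have := mul_le_mul_of_nonneg_left this hc
    simp only [φ]; linarith
  have hφm : Measurable fun z : (Fin n → Torus m) × Torus m => ∏ b, φ z.2 b (z.1 b) := by
    refine Finset.measurable_prod _ fun b _ => ?_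
    refine measurable_const.add (measurable_const.mul ?_)
    have hset : MeasurableSet {z : (Fin n → Torus m) × Torus m |
        z.1 b ∈ influenceRegion α β z.2 b} := by
      simp only [influenceRegion, Metric.mem_closedBall]
      exact measurableSet_le (by fun_prop) (by fun_prop)
    exact (measurable_one (α := ℝ)).indicator hset
  have hmp : MeasurePreserving (fun q : State n m × Innovation n m => (q.1.1, q.2.1))
      (π.prod (innovationLaw m p ν)) ((uniformPositions n m).prod volume) := by
    have := isProbabilityMeasure_uniformOn_fin hn
    have h1 : MeasurePreserving Prod.fst π (uniformPositions n m) :=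
      ⟨measurable_fst, h.map_fst hn⟩
    have h2 : MeasurePreserving (fun ω : Innovation n m => ω.1) (innovationLaw m p ν) volume :=
      measurePreserving_fst
    exact h1.prod h2
  have hbound : ∀ z : (Fin n → Torus m) × Torus m, ‖∏ b, φ z.2 b (z.1 b)‖ ≤
      ∏ _b : Fin n, Real.exp θ := by
    intro z
    rw [Real.norm_eq_abs, abs_of_nonneg (Finset.prod_nonneg fun b _ => hφ0 _ _ _)]
    exact Finset.prod_le_prod (fun b _ => hφ0 _ _ _) fun b _ => hφ1 _ _ _
  have hint : Integrable (fun z : (Fin n → Torus m) × Torus m => ∏ b, φ z.2 b (z.1 b))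
      ((uniformPositions n m).prod volume) :=
    Integrable.of_bound hφm.aestronglyMeasurable _ (Eventually.of_forall hbound)
  calc ∫ q, Real.exp (θ * ∑ b, hit α β q.1 q.2 b) ∂(π.prod (innovationLaw m p ν))
      ≤ ∫ q, (∏ b, φ q.2.1 b (q.1.1 b)) ∂(π.prod (innovationLaw m p ν)) := by
        refine integral_mono_of_nonneg (Eventually.of_forall fun q => (Real.exp_pos _).le)
          (hmp.integrable_comp_of_integrable hint) (Eventually.of_forall fun q => ?_)
        simp only
        rw [Finset.mul_sum, Real.exp_sum]
        refine Finset.prod_le_prod (fun b _ => (Real.exp_pos _).le) fun b _ => ?_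
        simp only [φ]
        by_cases h1 : q.1.1 b ∈ influenceRegion α β q.2.1 b
        · rw [Set.indicator_of_mem h1]
          simp only [Pi.one_apply, mul_one, add_sub_cancel]
          exact Real.exp_le_exp.2 (mul_le_of_le_one_right hθ (hit_le_one _ _ _))
        · have h2 : hit α β q.1 q.2 b = 0 := by
            refine if_neg fun h3 => h1 ?_
            have := h3.2
            rw [influenceRegion, Metric.mem_closedBall'] at this
            exact this
          rw [h2, Set.indicator_of_notMem h1]; simp
    _ = ∫ z, (∏ b, φ z.2 b (z.1 b)) ∂((uniformPositions n m).prod volume) := by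
        rw [← hmp.map_eq, integral_map hmp.measurable.aemeasurable hφm.aestronglyMeasurable]
    _ = ∫ y, ∫ x, (∏ b, φ y b (x b)) ∂(uniformPositions n m) := by
        rw [integral_prod_symm _ hint]
    _ = ∫ y : Torus m, ∏ b, (1 + (Real.exp θ - 1) * regionVolume n α β b) := by
        refine integral_congr_ae (Eventually.of_forall fun y => ?_)
        simp only
        rw [integral_fintype_prod_eq_prod (fun b x => φ y b x)]
        refine Finset.prod_congr rfl fun b _ => ?_
        have hreg : MeasurableSet (influenceRegion α β y b) := Metric.isClosed_closedBall.measurableSet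
        have hi : Integrable ((influenceRegion α β y b).indicator (1 : Torus m → ℝ))
            (volume : Measure (Torus m)) := (integrable_const (1 : ℝ)).indicator hreg
        simp only [φ]
        rw [integral_add (integrable_const _) (hi.const_mul _), integral_const_mul,
          integral_indicator_one hreg, volume_real_influenceRegion hm hα hβ]
        simp
    _ = _ := by simp

/-- The exponential degree functional. -/
def expDeg (θ : ℝ) (G : SimpleGraph (Fin n)) : ℝ := ∑ k, Real.exp (θ * deg G k)

theorem expDeg_nonneg (θ : ℝ) (G : SimpleGraph (Fin n)) : 0 ≤ expDeg θ G :=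
  Finset.sum_nonneg fun _ _ => (Real.exp_pos _).le

/-- The convex exponential lies below its chord over [0, 1]. -/
theorem exp_mul_le_of_mem_unit {θ x : ℝ} (hx0 : 0 ≤ x) (hx1 : x ≤ 1) :
    Real.exp (θ * x) ≤ 1 + (Real.exp θ - 1) * x := by
  have h := convexOn_exp.2 (Set.mem_univ 0) (Set.mem_univ θ) (by linarith : 0 ≤ 1 - x) hx0
    (by ring)
  simp only [smul_eq_mul, mul_zero, zero_add, Real.exp_zero, mul_one] at h
  rw [mul_comm θ x]
  linarith

/-- The term of the deleted node is replaced by that of the new one, whose degree is bounded by the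
number of all hits in order to remove the dependence on `D`. For survivors the possible loss of an
edge is discarded and the gain is linearised by convexity. -/
theorem expDeg_step_le {θ : ℝ} (hθ : 0 ≤ θ) (s : State n m) (ω : Innovation n m) :
    expDeg θ (step α β s ω).2 ≤
      ∑ i, Real.exp (θ * deg s.2 i) * ((if ω.2.2.1 ≠ i then 1 else 0) +
        (Real.exp θ - 1) * ((if ω.2.2.1 ≠ i then 1 else 0) * hit α β s ω i)) +
      Real.exp (θ * ∑ b, hit α β s ω b) := by
  rw [expDeg, ← Equiv.sum_comp (rankPerm ω.2.2.1 ω.2.2.2)]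
  simp_rw [deg_step]
  rw [← Finset.add_sum_erase _ _ (Finset.mem_univ ω.2.2.1), deg_stepGraph_deleted, add_comm]
  rw [← Finset.add_sum_erase Finset.univ (fun i => Real.exp (θ * deg s.2 i) *
    ((if ω.2.2.1 ≠ i then 1 else 0) +
        (Real.exp θ - 1) * ((if ω.2.2.1 ≠ i then 1 else 0) * hit α β s ω i)))
    (Finset.mem_univ ω.2.2.1)]
  simp only [ne_eq, not_true_eq_false, if_false, zero_mul, mul_zero, zero_add]
  refine add_le_add (Finset.sum_le_sum fun i hi => ?_)
    (Real.exp_le_exp.2 (mul_le_mul_of_nonneg_left (newDeg_le_sum s ω) hθ))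
  have hi' := Finset.ne_of_mem_erase hi
  simp only [hi'.symm, not_false_eq_true, if_true, one_mul]
  rw [deg_stepGraph_of_ne s ω hi']
  calc Real.exp (θ * (deg s.2 i - adjInd s.2 ω.2.2.1 i + hit α β s ω i))
      ≤ Real.exp (θ * deg s.2 i + θ * hit α β s ω i) := by
        rw [Real.exp_le_exp, ← mul_add]
        exact mul_le_mul_of_nonneg_left (by linarith [adjInd_nonneg s.2 ω.2.2.1 i]) hθ
    _ = Real.exp (θ * deg s.2 i) * Real.exp (θ * hit α β s ω i) := Real.exp_add _ _
    _ ≤ _ := by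
        gcongr
        exact exp_mul_le_of_mem_unit (hit_nonneg _ _ _) (hit_le_one _ _ _)

/-- A step multiplies the conditional mean of the old terms by at most 1 - 1/(2n) and adds a new
term of stationary mean at most 2. In the stationary state this forces the mean to be at most 4n;
boundedness of the functional allows its mean to be subtracted from both sides. -/
theorem IsGeoP.integral_expDeg_le (hn : 1 ≤ n) (hm : 1 ≤ m) (hα : 0 ≤ α) (hβ : 0 ≤ β)
    (hβ1 : β ≤ 1) {p : unitInterval} {ν : Measure (Fin n)} [IsProbabilityMeasure ν]
    {π : Measure (State n m)} (h : IsGeoP α β p ν π) :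
    ∫ s, expDeg ((n : ℝ) ^ (β - 1) / 4) s.2 ∂π ≤ 4 * n := by
  have := h.isProbabilityMeasure
  have := isProbabilityMeasure_innovationLaw hn m p ν
  set P := innovationLaw m p ν with hP
  set θ : ℝ := (n : ℝ) ^ (β - 1) / 4 with hθdef
  have hn0 : (0 : ℝ) < n := by exact_mod_cast hn
  have hn1 : (1 : ℝ) ≤ n := by exact_mod_cast hn
  have hθ : 0 ≤ θ := by positivity
  have hθ1 : θ ≤ 1 := by
    have : (n : ℝ) ^ (β - 1) ≤ 1 := Real.rpow_le_one_of_one_le_of_nonpos hn1 (by linarith)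
    rw [hθdef]; linarith
  set a : ℝ := Real.exp θ - 1 with ha
  have ha0 : 0 ≤ a := by linarith [Real.one_le_exp hθ]
  have ha2 : a ≤ 2 * θ := by
    have := Real.abs_exp_sub_one_le (x := θ) (by rw [abs_of_nonneg hθ]; exact hθ1)
    rw [abs_of_nonneg hθ] at this
    exact (le_abs_self _).trans this
  -- The exponent β - 1 balances the largest possible volume n^(-β) against the deletion rate 1/n.
  -- The divisor 4 in `θ` together with exp θ - 1 ≤ 2θ makes the growth at most half of that rate.
  have hav : ∀ b : Fin n, a * regionVolume n α β b ≤ 1 / (2 * n) := by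
    intro b
    calc a * regionVolume n α β b ≤ (2 * θ) * (n : ℝ) ^ (-β) :=
          mul_le_mul ha2 (regionVolume_le hα b) (regionVolume_nonneg b) (by positivity)
      _ = 1 / 2 * ((n : ℝ) ^ (β - 1) * (n : ℝ) ^ (-β)) := by rw [hθdef]; ring
      _ = 1 / (2 * n) := by
          rw [← Real.rpow_add hn0, show β - 1 + -β = (-1 : ℝ) by ring, Real.rpow_neg_one]
          field_simp
  have hbdd : ∀ G : SimpleGraph (Fin n), expDeg θ G ≤ n * Real.exp (θ * n) := by
    intro G
    refine (Finset.sum_le_sum fun k _ => Real.exp_le_exp.2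
      (mul_le_mul_of_nonneg_left (deg_le G k) hθ)).trans ?_
    simp
  have hFint : Integrable (fun s : State n m => expDeg θ s.2) π :=
    Integrable.of_bound (measurable_graph_observable _).aestronglyMeasurable
      (n * Real.exp (θ * n)) (Eventually.of_forall fun s => by
        rw [Real.norm_eq_abs, abs_of_nonneg (expDeg_nonneg _ _)]; exact hbdd _)
  have hmp := h.measurePreserving_step hn
  have hEint : Integrable (fun q : State n m × Innovation n m =>
      Real.exp (θ * ∑ b, hit α β q.1 q.2 b)) (π.prod P) := by
    refine Integrable.of_bound ?_ (Real.exp (θ * n)) (Eventually.of_forall fun q => ?_)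
    · exact (Real.measurable_exp.comp (measurable_const.mul
        (Finset.measurable_sum _ fun b _ => measurable_hit b))).aestronglyMeasurable
    · rw [Real.norm_eq_abs, Real.abs_exp, Real.exp_le_exp]
      refine mul_le_mul_of_nonneg_left ?_ hθ
      refine (Finset.sum_le_sum fun b _ => hit_le_one q.1 q.2 b).trans ?_
      simp
  have hstep : ∀ s, ∫ ω, expDeg θ (step α β s ω).2 ∂P ≤
      (1 - 1 / (2 * n)) * expDeg θ s.2 + ∫ ω, Real.exp (θ * ∑ b, hit α β s ω b) ∂P := by
    intro s
    have hi1 : ∀ i : Fin n, Integrable (fun ω : Innovation n m =>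
        (if ω.2.2.1 ≠ i then (1 : ℝ) else 0)) P := by
      intro i
      refine Integrable.of_bound ?_ 1 (Eventually.of_forall fun ω => ?_)
      · exact ((Measurable.of_discrete (f := fun d : Fin n => if d ≠ i then (1 : ℝ) else 0)).comp
          (by fun_prop)).aestronglyMeasurable
      · split_ifs <;> simp
    have hi2 := fun i : Fin n => integrable_mul_hit (α := α) (β := β) P
      (fun d => if d ≠ i then 1 else 0) s i
    have hi3 : Integrable (fun ω => Real.exp (θ * ∑ b, hit α β s ω b)) P := by
      refine Integrable.of_bound ?_ (Real.exp (θ * n)) (Eventually.of_forall fun ω => ?_)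
      · exact (Real.measurable_exp.comp (measurable_const.mul
          (Finset.measurable_sum _ fun b _ => measurable_hit_right s b))).aestronglyMeasurable
      · rw [Real.norm_eq_abs, Real.abs_exp, Real.exp_le_exp]
        refine mul_le_mul_of_nonneg_left ?_ hθ
        refine (Finset.sum_le_sum fun b _ => hit_le_one s ω b).trans ?_
        simp
    have hi4 : ∀ i : Fin n, Integrable (fun ω : Innovation n m => Real.exp (θ * deg s.2 i) *
        ((if ω.2.2.1 ≠ i then 1 else 0) +
          a * ((if ω.2.2.1 ≠ i then 1 else 0) * hit α β s ω i))) P := fun i => ((hi1 i).add ((hi2 i).const_mul a)).const_mul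
      (Real.exp (θ * deg s.2 i))
    refine (integral_mono_of_nonneg (Eventually.of_forall fun ω => expDeg_nonneg _ _)
      ((integrable_finsetSum Finset.univ fun i _ => hi4 i).add hi3)
      (Eventually.of_forall fun ω => expDeg_step_le hθ s ω)).trans ?_
    rw [integral_add' (integrable_finsetSum Finset.univ fun i _ => hi4 i) hi3,
      integral_finsetSum _ fun i _ => hi4 i]
    refine add_le_add_left ?_ _
    rw [expDeg, Finset.mul_sum]
    refine Finset.sum_le_sum fun i _ => ?_
    rw [integral_const_mul, integral_add (hi1 i) ((hi2 i).const_mul a), integral_const_mul,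
      integral_mul_hit hn hm hα hβ p ν (fun d => if d ≠ i then 1 else 0) s i,
      integral_deleted hn p ν (fun d => if d ≠ i then 1 else 0), sum_ne_div hn, mul_comm]
    refine mul_le_mul_of_nonneg_right ?_ (Real.exp_pos _).le
    -- Survival and growth combine to (1 - 1/n)(1 + 1/(2n)) ≤ 1 - 1/(2n).
    have hpv : a * (p * regionVolume n α β i) ≤ 1 / (2 * n) := by
      refine le_trans ?_ (hav i)
      refine mul_le_mul_of_nonneg_left ?_ ha0
      exact mul_le_of_le_one_left (regionVolume_nonneg i) p.2.2
    have h1n : (1 : ℝ) / n ≤ 1 := by rw [div_le_one hn0]; exact hn1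
    have h2n : (1 : ℝ) / (2 * n) = 1 / n / 2 := by field_simp
    rw [h2n] at hpv ⊢
    have h0n : (0 : ℝ) ≤ 1 / n := by positivity
    have := mul_le_mul_of_nonneg_left hpv (by linarith : (0 : ℝ) ≤ 1 - 1 / n)
    have h5 : a * ((1 - 1 / (n : ℝ)) * (p * regionVolume n α β i)) =
      (1 - 1 / n) * (a * (p * regionVolume n α β i)) := by ring
    rw [h5]
    nlinarith [mul_nonneg h0n h0n]
  have hmain : ∫ s, expDeg θ s.2 ∂π ≤ (1 - 1 / (2 * n)) * ∫ s, expDeg θ s.2 ∂π + 2 := by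
    have hint' : Integrable (fun q : State n m × Innovation n m =>
        expDeg θ (step α β q.1 q.2).2) (π.prod P) := hmp.integrable_comp_of_integrable hFint
    calc ∫ s, expDeg θ s.2 ∂π
        = ∫ q, expDeg θ (step α β q.1 q.2).2 ∂(π.prod P) := by
          conv_lhs => rw [← hmp.map_eq]
          rw [integral_map hmp.measurable.aemeasurable
            (measurable_graph_observable _).aestronglyMeasurable]
      _ = ∫ s, ∫ ω, expDeg θ (step α β s ω).2 ∂P ∂π := integral_prod _ hint'
      _ ≤ ∫ s, ((1 - 1 / (2 * n)) * expDeg θ s.2 +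
            ∫ ω, Real.exp (θ * ∑ b, hit α β s ω b) ∂P) ∂π :=
          integral_mono hint'.integral_prod_left
            ((hFint.const_mul _).add hEint.integral_prod_left) hstep
      _ = (1 - 1 / (2 * n)) * ∫ s, expDeg θ s.2 ∂π +
            ∫ q, Real.exp (θ * ∑ b, hit α β q.1 q.2 b) ∂(π.prod P) := by
          rw [integral_add (hFint.const_mul _) hEint.integral_prod_left, integral_const_mul,
            integral_prod _ hEint]
      _ ≤ _ := by
          gcongr
          refine (integral_exp_sum_hit_le hn hm hα hβ h hθ).trans ?_
          calc ∏ b, (1 + (Real.exp θ - 1) * regionVolume n α β b)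
              ≤ ∏ _b : Fin n, (1 + 1 / (2 * (n : ℝ))) := by
                refine Finset.prod_le_prod (fun b _ => ?_) fun b _ => ?_
                · have := mul_nonneg ha0 (regionVolume_nonneg (α := α) (β := β) b)
                  linarith
                · have := hav b
                  linarith
            _ ≤ ∏ _b : Fin n, Real.exp (1 / (2 * (n : ℝ))) := by
                refine Finset.prod_le_prod (fun b _ => by positivity) fun b _ => ?_
                linarith [Real.add_one_le_exp (1 / (2 * (n : ℝ)))]
            _ = Real.exp (1 / 2) := by
                rw [Finset.prod_const, ← Real.exp_nat_mul]
                congr 1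
                simp
                field_simp
            _ ≤ 2 := by
                have h1 : Real.exp (1 / 2) ^ 2 = Real.exp 1 := by
                  rw [← Real.exp_nat_mul]; norm_num
                have h2 := Real.exp_one_lt_d9
                nlinarith [Real.exp_pos (1 / 2)]
  have h3 : 1 / (2 * (n : ℝ)) * ∫ s, expDeg θ s.2 ∂π ≤ 2 := by linarith
  rw [div_mul_eq_mul_div, one_mul, div_le_iff₀ (by positivity)] at h3
  linarith

/-- In the stationary state, no node has a degree much larger than `n ^ (1 - β)`. -/
theorem IsGeoP.measureReal_exists_deg_gt_le (hn : 1 ≤ n) (hm : 1 ≤ m) (hα : 0 ≤ α) (hβ : 0 ≤ β)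
    (hβ1 : β ≤ 1) {p : unitInterval} {ν : Measure (Fin n)} [IsProbabilityMeasure ν]
    {π : Measure (State n m)} (h : IsGeoP α β p ν π) (B : ℝ) :
    π.real {s | ∃ k, B < deg s.2 k} ≤ 4 * n * Real.exp (-((n : ℝ) ^ (β - 1) / 4 * B)) := by
  have := h.isProbabilityMeasure
  set θ : ℝ := (n : ℝ) ^ (β - 1) / 4 with hθdef
  have hθ : 0 ≤ θ := by positivity
  have hFint : Integrable (fun s : State n m => expDeg θ s.2) π := by
    refine Integrable.of_bound (measurable_graph_observable _).aestronglyMeasurable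
      (∑ _k : Fin n, Real.exp (θ * n)) (Eventually.of_forall fun s => ?_)
    rw [Real.norm_eq_abs, abs_of_nonneg (expDeg_nonneg _ _)]
    exact Finset.sum_le_sum fun k _ => Real.exp_le_exp.2
      (mul_le_mul_of_nonneg_left (deg_le s.2 k) hθ)
  have h1 := mul_meas_ge_le_integral_of_nonneg (μ := π) (Eventually.of_forall fun s =>
    expDeg_nonneg θ s.2) hFint (Real.exp (θ * B))
  have h2 : π.real {s | ∃ k, B < deg s.2 k} ≤ π.real {s | Real.exp (θ * B) ≤ expDeg θ s.2} := by
    refine measureReal_mono ?_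
    rintro s ⟨k, hk⟩
    refine (Real.exp_le_exp.2 (mul_le_mul_of_nonneg_left hk.le hθ)).trans ?_
    exact Finset.single_le_sum (f := fun k => Real.exp (θ * deg s.2 k))
      (fun k _ => (Real.exp_pos _).le) (Finset.mem_univ k)
  have h3 := h1.trans (h.integral_expDeg_le hn hm hα hβ hβ1)
  rw [Real.exp_neg, ← div_eq_mul_inv, le_div_iff₀ (Real.exp_pos _), mul_comm]
  exact (mul_le_mul_of_nonneg_left h2 (Real.exp_pos _).le).trans h3

/-! ### Concentration of the number of edges -/

/-- The exponential function `x ↦ exp (θ * x)`, continued linearly beyond `L`. -/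
def cappedExp (θ L x : ℝ) : ℝ :=
  if x ≤ L then Real.exp (θ * x) else Real.exp (θ * L) * (1 + θ * (x - L))

theorem cappedExp_nonneg {θ : ℝ} (hθ : 0 ≤ θ) (L x : ℝ) : 0 ≤ cappedExp θ L x := by
  unfold cappedExp
  split_ifs with h
  · positivity
  · have : 0 ≤ x - L := by linarith
    positivity

/-- Beyond `L` the function follows the tangent of the exponential at `L`. -/
theorem cappedExp_le_exp (θ L x : ℝ) : cappedExp θ L x ≤ Real.exp (θ * x) := by
  unfold cappedExp
  split_ifs with h
  · exact le_rfl
  · calc Real.exp (θ * L) * (1 + θ * (x - L))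
        ≤ Real.exp (θ * L) * Real.exp (θ * (x - L)) := by
          gcongr
          linarith [Real.add_one_le_exp (θ * (x - L))]
      _ = Real.exp (θ * x) := by rw [← Real.exp_add]; ring_nf

/-- This crude bound serves on the event of a large degree, where it is polynomial in n apart from
the factor exp(θL). -/
theorem cappedExp_le {θ L : ℝ} (hθ : 0 ≤ θ) (hL : 0 ≤ L) (x : ℝ) :
    cappedExp θ L x ≤ Real.exp (θ * L) * (1 + θ * |x|) := by
  unfold cappedExp
  split_ifs with h
  · calc Real.exp (θ * x) ≤ Real.exp (θ * L) := by gcongr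
      _ ≤ _ := le_mul_of_one_le_right (Real.exp_pos _).le
          (by linarith [mul_nonneg hθ (abs_nonneg x)])
  · gcongr
    linarith [le_abs_self x]

/-- Second-order expansion with slope θ exp(θ min x L). Below `L` it is exp v ≤ 1 + v + v² for |v| ≤
1. Beyond `L` the function is linear; if the increment leads back below `L`, then v = θ(x + δ - L)
lies between θδ and 0, so v² ≤ (θδ)². -/
theorem cappedExp_add_le {θ : ℝ} (hθ : 0 ≤ θ) (L x : ℝ) {δ : ℝ} (hδ : |θ * δ| ≤ 1) :
    cappedExp θ L (x + δ) ≤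
      cappedExp θ L x + Real.exp (θ * min x L) * (θ * δ + (θ * δ) ^ 2) := by
  have hexp : ∀ u : ℝ, |u| ≤ 1 → Real.exp u ≤ 1 + u + u ^ 2 := by
    intro u hu
    have := Real.abs_exp_sub_one_sub_id_le hu
    linarith [le_abs_self (Real.exp u - 1 - u)]
  by_cases hx : x ≤ L
  · rw [min_eq_left hx]
    have h1 : cappedExp θ L x = Real.exp (θ * x) := if_pos hx
    rw [h1]
    calc cappedExp θ L (x + δ) ≤ Real.exp (θ * (x + δ)) := cappedExp_le_exp _ _ _
      _ = Real.exp (θ * x) * Real.exp (θ * δ) := by rw [← Real.exp_add]; ring_nf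
      _ ≤ Real.exp (θ * x) * (1 + θ * δ + (θ * δ) ^ 2) := by gcongr; exact hexp _ hδ
      _ = _ := by ring
  · have hx' : L < x := not_le.1 hx
    rw [min_eq_right hx'.le]
    have h1 : cappedExp θ L x = Real.exp (θ * L) * (1 + θ * (x - L)) := if_neg hx
    rw [h1, ← mul_add]
    by_cases hy : x + δ ≤ L
    · have h2 : cappedExp θ L (x + δ) = Real.exp (θ * (x + δ)) := if_pos hy
      have h3 : θ * (x + δ) = θ * L + θ * (x + δ - L) := by ring
      rw [h2, h3, Real.exp_add]
      gcongr
      have h4 : θ * δ ≤ θ * (x + δ - L) := by gcongr; linarith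
      have h5 : θ * (x + δ - L) ≤ 0 := mul_nonpos_of_nonneg_of_nonpos hθ (by linarith)
      have h6 := (abs_le.1 hδ).1
      have h7 : (θ * (x + δ - L)) ^ 2 ≤ (θ * δ) ^ 2 := by
        rw [sq_le_sq, abs_of_nonpos h5, abs_of_nonpos (h4.trans h5)]
        linarith
      have := hexp (θ * (x + δ - L)) (by rw [abs_le]; constructor <;> linarith)
      linarith
    · have h2 : cappedExp θ L (x + δ) = Real.exp (θ * L) * (1 + θ * (x + δ - L)) := if_neg hy
      rw [h2]
      refine mul_le_mul_of_nonneg_left ?_ (Real.exp_pos _).le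
      have h3 : θ * (x + δ - L) = θ * (x - L) + θ * δ := by ring
      rw [h3]
      have := sq_nonneg (θ * δ)
      linarith

/-- The stationary mean number of edges. -/
def meanEdges (n : ℕ) (α β : ℝ) (p : unitInterval) : ℝ := n / 2 * meanNewDeg n α β p

theorem meanEdges_nonneg (hn : 1 ≤ n) (p : unitInterval) : 0 ≤ meanEdges n α β p :=
  mul_nonneg (by positivity) (meanNewDeg_nonneg hn p)

theorem meanEdges_le (hn : 1 ≤ n) (hα : 0 ≤ α) (hβ : 0 ≤ β) (p : unitInterval) :
    meanEdges n α β p ≤ (n : ℝ) ^ 2 := by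
  have hn1 : (1 : ℝ) ≤ n := by exact_mod_cast hn
  have h1 : ∑ b, regionVolume n α β b ≤ n := by
    calc ∑ b, regionVolume n α β b ≤ ∑ _b : Fin n, (1 : ℝ) :=
          Finset.sum_le_sum fun b _ => (regionVolume_le hα b).trans
            (Real.rpow_le_one_of_one_le_of_nonpos hn1 (by linarith))
      _ = n := by simp
  have h0 : 0 ≤ ∑ b, regionVolume n α β b := Finset.sum_nonneg fun b _ => regionVolume_nonneg b
  have h2 : (p : ℝ) * ∑ b, regionVolume n α β b ≤ n := (mul_le_of_le_one_left h0 p.2.2).trans h1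
  have h3 : meanNewDeg n α β p ≤ n := by
    refine (mul_le_of_le_one_left (mul_nonneg p.2.1 h0) ?_).trans h2
    have : (0 : ℝ) ≤ 1 / n := by positivity
    linarith
  unfold meanEdges
  have := mul_le_mul_of_nonneg_left h3 (by positivity : (0 : ℝ) ≤ n / 2)
  nlinarith

theorem integrable_prod_of_bound {Ω Ω' : Type*} [MeasurableSpace Ω] [MeasurableSpace Ω']
    {μ : Measure Ω} {ν : Measure Ω'} [IsFiniteMeasure μ] [IsFiniteMeasure ν] {f : Ω × Ω' → ℝ}
    (hf : Measurable f) (C : ℝ) (hC : ∀ q, |f q| ≤ C) :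
    Integrable f (μ.prod ν) :=
  Integrable.of_bound hf.aestronglyMeasurable C (Eventually.of_forall hC)

/-- If no degree exceeds `B` before or after the step, the increment δ satisfies |δ| ≤ B, and δ² is
at most `B` times the sum of the two degrees, which is linear and so has a computable conditional
mean. Otherwise the last term pays for everything: one θn² bounds the capped exponential, the other
a negative first-order term. The sign `ε` covers both tails. -/
theorem cappedExp_step_le {θ B : ℝ} (hθ : 0 < θ) (hB : 0 ≤ B) (hθB : θ * B ≤ 1) {L : ℝ}
    (hL : 0 ≤ L) (hn : 1 ≤ n) (hα : 0 ≤ α) (hβ : 0 ≤ β) (p : unitInterval) {ε : ℝ} (hε : |ε| = 1)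
    (s : State n m) (ω : Innovation n m) :
    cappedExp θ L (ε * (numEdges (step α β s ω).2 - meanEdges n α β p)) ≤
      cappedExp θ L (ε * (numEdges s.2 - meanEdges n α β p)) +
      Real.exp (θ * min (ε * (numEdges s.2 - meanEdges n α β p)) L) *
        (θ * (ε * (newDeg α β s ω - deg s.2 ω.2.2.1)) +
          θ ^ 2 * B * (newDeg α β s ω + deg s.2 ω.2.2.1)) +
      Real.exp (θ * L) * (1 + 2 * θ * n ^ 2) *
        (({r : State n m | ∃ k, B < deg r.2 k}).indicator 1 s +
          ({r : State n m | ∃ k, B < deg r.2 k}).indicator 1 (step α β s ω)) := by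
  set q := meanEdges n α β p with hq
  set bad := {r : State n m | ∃ k, B < deg r.2 k} with hbad
  set x := ε * (numEdges s.2 - q) with hx
  set δ := ε * (newDeg α β s ω - deg s.2 ω.2.2.1) with hδ
  set W := newDeg α β s ω + deg s.2 ω.2.2.1 with hW
  have hn1 : (1 : ℝ) ≤ n := by exact_mod_cast hn
  have hstep : ε * (numEdges (step α β s ω).2 - q) = x + δ := by
    rw [numEdges_step, hx, hδ]; ring
  have hN0 := newDeg_nonneg (α := α) (β := β) s ω
  have hD0 := deg_nonneg s.2 ω.2.2.1
  have hNn := newDeg_le (α := α) (β := β) s ω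
  have hDn := deg_le s.2 ω.2.2.1
  have hW0 : 0 ≤ W := add_nonneg hN0 hD0
  have hδabs : |δ| = |newDeg α β s ω - deg s.2 ω.2.2.1| := by rw [hδ, abs_mul, hε, one_mul]
  have hδW : |δ| ≤ W := by rw [hδabs, abs_le]; constructor <;> linarith
  have hδn : |δ| ≤ n := by rw [hδabs, abs_le]; constructor <;> linarith
  set g := Real.exp (θ * min x L) with hg
  have hg0 : 0 < g := Real.exp_pos _
  have hgL : g ≤ Real.exp (θ * L) := by
    rw [hg]; gcongr; exact min_le_right _ _
  have hind : ∀ r : State n m, 0 ≤ bad.indicator (1 : State n m → ℝ) r := fun r =>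
    Set.indicator_nonneg (fun _ _ => zero_le_one) _
  have hK : 0 ≤ Real.exp (θ * L) * (1 + 2 * θ * (n : ℝ) ^ 2) := by positivity
  have hWterm : 0 ≤ θ ^ 2 * B * W := by positivity
  rw [hstep]
  by_cases hgood : s ∉ bad ∧ step α β s ω ∉ bad
  · rw [Set.indicator_of_notMem hgood.1, Set.indicator_of_notMem hgood.2, add_zero, mul_zero,
      add_zero]
    have h1 : deg s.2 ω.2.2.1 ≤ B := by
      by_contra! hc; exact hgood.1 ⟨_, hc⟩
    -- The new degree is a degree of the graph after the step, which is why that state must be good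
    -- as well.
    have h2 : newDeg α β s ω ≤ B := by
      by_contra! hc
      exact hgood.2 ⟨ω.2.2.2, by rwa [deg_step_deleted]⟩
    have hδB : |δ| ≤ B := by rw [hδabs, abs_le]; constructor <;> linarith
    have h3 : |θ * δ| ≤ 1 := by
      rw [abs_mul, abs_of_pos hθ]
      exact (mul_le_mul_of_nonneg_left hδB hθ.le).trans hθB
    refine (cappedExp_add_le hθ.le L x h3).trans ?_
    gcongr
    rw [mul_pow, mul_assoc]
    gcongr
    rw [← sq_abs, sq]
    exact mul_le_mul hδB hδW (abs_nonneg _) hB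
  · have hone : 1 ≤ bad.indicator (1 : State n m → ℝ) s + bad.indicator 1 (step α β s ω) := by
      rw [not_and_or, not_not, not_not] at hgood
      rcases hgood with h | h
      · have := hind (step α β s ω)
        rw [Set.indicator_of_mem h]; simpa using this
      · have := hind s
        rw [Set.indicator_of_mem h]; simpa using this
    have h1 : cappedExp θ L (x + δ) ≤ Real.exp (θ * L) * (1 + θ * (n : ℝ) ^ 2) := by
      refine (cappedExp_le hθ.le hL _).trans ?_
      gcongr
      rw [← hstep, abs_mul, hε, one_mul, abs_le]
      have := numEdges_nonneg (step α β s ω).2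
      have := numEdges_le (step α β s ω).2
      have := meanEdges_nonneg (α := α) (β := β) hn p
      have := meanEdges_le hn hα hβ p
      constructor <;> linarith
    have h2 : -(Real.exp (θ * L) * (θ * (n : ℝ) ^ 2)) ≤ g * (θ * δ) := by
      have h3 : |g * (θ * δ)| ≤ Real.exp (θ * L) * (θ * (n : ℝ) ^ 2) := by
        rw [abs_mul, abs_mul, abs_of_pos hg0, abs_of_pos hθ]
        have : (n : ℝ) ≤ n ^ 2 := by nlinarith
        gcongr
        exact hδn.trans this
      linarith [(abs_le.1 h3).1]
    have h3 := cappedExp_nonneg hθ.le L x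
    have h4 := mul_nonneg hg0.le hWterm
    have h5 := mul_le_mul_of_nonneg_left hone hK
    rw [mul_add g]
    have h6 : Real.exp (θ * L) * (1 + 2 * θ * (n : ℝ) ^ 2) =
      Real.exp (θ * L) * (1 + θ * (n : ℝ) ^ 2) + Real.exp (θ * L) * (θ * (n : ℝ) ^ 2) := by ring
    linarith

/-- The stationarity equation for the capped exponential of the centred number of edges. -/
theorem IsGeoP.integral_exp_mul_le (hn : 1 ≤ n) (hm : 1 ≤ m) (hα : 0 ≤ α) (hβ : 0 ≤ β)
    {p : unitInterval} {ν : Measure (Fin n)} [IsProbabilityMeasure ν]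
    {π : Measure (State n m)} (h : IsGeoP α β p ν π) {θ B : ℝ} (hθ : 0 < θ) (hB : 0 ≤ B)
    (hθB : θ * B ≤ 1) {L : ℝ} (hL : 0 ≤ L) {ε : ℝ} (hε : |ε| = 1) :
    ∫ s, Real.exp (θ * min (ε * (numEdges s.2 - meanEdges n α β p)) L) *
        (ε * (numEdges s.2 - meanEdges n α β p) -
          θ * B * (meanEdges n α β p + numEdges s.2)) ∂π ≤
      n / θ * (Real.exp (θ * L) * (1 + 2 * θ * n ^ 2)) *
        π.real {s | ∃ k, B < deg s.2 k} := by
  have := h.isProbabilityMeasure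
  have := isProbabilityMeasure_innovationLaw hn m p ν
  set P := innovationLaw m p ν with hP
  have hmp := h.measurePreserving_step hn
  rw [← hP] at hmp
  set q := meanEdges n α β p with hq
  set bad := {r : State n m | ∃ k, B < deg r.2 k} with hbad
  set K := Real.exp (θ * L) * (1 + 2 * θ * (n : ℝ) ^ 2) with hK
  have hn0 : (0 : ℝ) < n := by exact_mod_cast hn
  -- There are finitely many graphs on `n` nodes, so every real function of the graph is bounded.
  have hobs : ∀ f : SimpleGraph (Fin n) → ℝ, Integrable (fun s : State n m => f s.2) π := by
    intro f
    refine Integrable.of_bound (measurable_graph_observable f).aestronglyMeasurable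
      (∑ G, |f G|) (Eventually.of_forall fun s => ?_)
    exact Finset.single_le_sum (f := fun G => |f G|) (fun G _ => abs_nonneg _) (Finset.mem_univ _)
  have hbadm : MeasurableSet bad := by
    classical
    have := measurable_graph_observable (m := m)
      (fun G : SimpleGraph (Fin n) => if ∃ k, B < deg G k then 1 else 0)
    have h2 : bad = (fun s : State n m => if ∃ k, B < deg s.2 k then (1 : ℝ) else 0) ⁻¹' {1} := by
      ext s
      simp [hbad]
    rw [h2]
    exact this (measurableSet_singleton 1)
  let f : SimpleGraph (Fin n) → ℝ := fun G => cappedExp θ L (ε * (numEdges G - q))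
  let g : SimpleGraph (Fin n) → ℝ := fun G => Real.exp (θ * min (ε * (numEdges G - q)) L)
  let Z : State n m × Innovation n m → ℝ := fun z =>
    θ * (ε * (newDeg α β z.1 z.2 - deg z.1.2 z.2.2.2.1)) +
          θ ^ 2 * B * (newDeg α β z.1 z.2 + deg z.1.2 z.2.2.2.1)
  have hdegm : Measurable fun z : State n m × Innovation n m => deg z.1.2 z.2.2.2.1 := by
    have h1 : Measurable fun w : State n m × Fin n => deg w.1.2 w.2 :=
      measurable_from_prod_countable_left fun d => measurable_graph_observable fun G => deg G d
    exact h1.comp (g := fun w : State n m × Fin n => deg w.1.2 w.2)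
      (f := fun z : State n m × Innovation n m => (z.1, z.2.2.2.1)) (by fun_prop)
  have hZm : Measurable Z :=
    (measurable_const.mul (measurable_const.mul (measurable_newDeg.sub hdegm))).add
      (measurable_const.mul (measurable_newDeg.add hdegm))
  have hZb : ∀ z, |Z z| ≤ θ * n + θ ^ 2 * B * (2 * n) := by
    intro z
    have h1 := newDeg_nonneg (α := α) (β := β) z.1 z.2
    have h2 := newDeg_le (α := α) (β := β) z.1 z.2
    have h3 := deg_nonneg z.1.2 z.2.2.2.1
    have h4 := deg_le z.1.2 z.2.2.2.1
    refine (abs_add_le _ _).trans ?_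
    rw [abs_mul, abs_mul, hε, one_mul, abs_of_pos hθ, abs_mul, abs_of_nonneg (by positivity :
      0 ≤ θ ^ 2 * B)]
    gcongr
    · rw [abs_le]; constructor <;> linarith
    · rw [abs_le]; constructor <;> linarith
  have hgZ : Integrable (fun z : State n m × Innovation n m => g z.1.2 * Z z) (π.prod P) := by
    refine integrable_prod_of_bound (((measurable_graph_observable g).comp measurable_fst).mul hZm)
      (Real.exp (θ * L) * (θ * n + θ ^ 2 * B * (2 * n))) fun z => ?_
    rw [abs_mul]
    have : |g z.1.2| ≤ Real.exp (θ * L) := by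
      simp only [g, Real.abs_exp]
      gcongr
      exact min_le_right _ _
    gcongr
    exact hZb z
  have hf1 : Integrable (fun z : State n m × Innovation n m => f z.1.2) (π.prod P) :=
    (hobs f).comp_fst P
  have hf2 : Integrable (fun z : State n m × Innovation n m => f (step α β z.1 z.2).2)
      (π.prod P) := hmp.integrable_comp_of_integrable (hobs f)
  have hbi : Integrable (bad.indicator (1 : State n m → ℝ)) π :=
    (integrable_const (1 : ℝ)).indicator hbadm
  have hb1 : Integrable (fun z : State n m × Innovation n m =>
      bad.indicator (1 : State n m → ℝ) z.1) (π.prod P) := hbi.comp_fst P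
  have hb2 : Integrable (fun z : State n m × Innovation n m =>
      bad.indicator (1 : State n m → ℝ) (step α β z.1 z.2)) (π.prod P) :=
    hmp.integrable_comp_of_integrable hbi
  have hfg : Integrable (fun z : State n m × Innovation n m => f z.1.2 + g z.1.2 * Z z)
      (π.prod P) := hf1.add hgZ
  have hbb : Integrable (fun z : State n m × Innovation n m =>
      K * (bad.indicator (1 : State n m → ℝ) z.1 + bad.indicator 1 (step α β z.1 z.2)))
      (π.prod P) := (hb1.add hb2).const_mul K
  -- By stationarity the mean of `f` is the same before and after the step and cancels. What remains
  -- bounds the drift from below by the cost of large degrees, counted once before and once after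
  -- the step.
  have hle : ∫ z, f (step α β z.1 z.2).2 ∂(π.prod P) ≤
      ∫ z, (f z.1.2 + g z.1.2 * Z z + K * (bad.indicator 1 z.1 +
        bad.indicator 1 (step α β z.1 z.2))) ∂(π.prod P) :=
    integral_mono hf2 (hfg.add hbb)
      fun z => cappedExp_step_le hθ hB hθB hL hn hα hβ p hε z.1 z.2
  have e1 : ∫ z, f (step α β z.1 z.2).2 ∂(π.prod P) = ∫ s, f s.2 ∂π := by
    conv_rhs => rw [← hmp.map_eq]
    rw [integral_map hmp.measurable.aemeasurable
      (measurable_graph_observable _).aestronglyMeasurable]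
  have e2 : ∫ z, f z.1.2 ∂(π.prod P) = ∫ s, f s.2 ∂π := by
    rw [integral_prod _ hf1]; simp
  have e3 : ∫ z, bad.indicator (1 : State n m → ℝ) z.1 ∂(π.prod P) = π.real bad := by
    rw [integral_prod _ hb1]; simp [integral_indicator_one hbadm]
  have e4 : ∫ z, bad.indicator (1 : State n m → ℝ) (step α β z.1 z.2) ∂(π.prod P) =
      π.real bad := by
    rw [← integral_indicator_one hbadm]
    conv_rhs => rw [← hmp.map_eq]
    rw [integral_map hmp.measurable.aemeasurable
      ((measurable_one (α := ℝ)).indicator hbadm).aestronglyMeasurable]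
  -- Given `s`, the new degree has mean 2q/n and the degree of the deleted node 2Q/n. Their
  -- difference gives the restoring drift, their sum the second-order term.
  have e5 : ∫ z, g z.1.2 * Z z ∂(π.prod P) =
      -(2 * θ / n) * ∫ s, g s.2 * (ε * (numEdges s.2 - q) - θ * B * (q + numEdges s.2)) ∂π := by
    rw [integral_prod _ hgZ, ← integral_const_mul]
    refine integral_congr_ae (Eventually.of_forall fun s => ?_)
    have hi1 := integrable_newDeg (α := α) (β := β) P s
    have hi2 := integrable_deg_deleted P s
    have hi3 : Integrable (fun ω => θ * (ε * (newDeg α β s ω - deg s.2 ω.2.2.1))) P :=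
      ((hi1.sub hi2).const_mul ε).const_mul θ
    have hi4 : Integrable (fun ω => θ ^ 2 * B * (newDeg α β s ω + deg s.2 ω.2.2.1)) P :=
      (hi1.add hi2).const_mul _
    simp only [Z]
    rw [integral_const_mul, integral_add hi3 hi4, integral_const_mul, integral_const_mul, integral_const_mul,
      integral_sub hi1 hi2, integral_add hi1 hi2, integral_newDeg hn hm hα hβ p ν s,
      integral_deg_deleted hn p ν s]
    have hM : meanNewDeg n α β p = 2 * q / n := by
      rw [hq, meanEdges]; field_simp
    rw [hM]
    field_simp
    ring
  rw [e1, integral_add hfg hbb, integral_add hf1 hgZ,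
    integral_const_mul, integral_add hb1 hb2, e2, e3, e4, e5] at hle
  have h6 : 2 * θ / n * ∫ s, g s.2 * (ε * (numEdges s.2 - q) - θ * B * (q + numEdges s.2)) ∂π ≤
      2 * K * π.real bad := by linarith
  have h7 : ∀ I : ℝ, 2 * θ / n * I ≤ 2 * K * π.real bad → I ≤ n / θ * K * π.real bad := by
    intro I hI
    have : n / (2 * θ) * (2 * θ / n * I) ≤ n / (2 * θ) * (2 * K * π.real bad) :=
      mul_le_mul_of_nonneg_left hI (by positivity)
    calc I = n / (2 * θ) * (2 * θ / n * I) := by field_simp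
      _ ≤ _ := this
      _ = _ := by field_simp
  exact h7 _ h6

/-- A deviation bound for the number of edges in the stationary state. -/
theorem IsGeoP.exp_mul_measureReal_le (hn : 1 ≤ n) (hm : 1 ≤ m) (hα : 0 ≤ α) (hβ : 0 ≤ β)
    {p : unitInterval} {ν : Measure (Fin n)} [IsProbabilityMeasure ν]
    {π : Measure (State n m)} (h : IsGeoP α β p ν π) {θ B : ℝ} (hθ : 0 < θ) (hB : 0 ≤ B)
    (hθB : 8 * θ * B ≤ 1) {ε : ℝ} (hε : |ε| = 1) {u : ℝ}
    (hu : u = 8 * θ * B * meanEdges n α β p) :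
    Real.exp (2 * θ * u) * u *
        π.real {s | 2 * u ≤ ε * (numEdges s.2 - meanEdges n α β p)} ≤
      2 * n ^ 2 * Real.exp (θ * u) +
      n / θ * (Real.exp (2 * θ * u) * (1 + 2 * θ * n ^ 2)) *
        π.real {s | ∃ k, B < deg s.2 k} := by
  have := h.isProbabilityMeasure
  set q := meanEdges n α β p with hq
  have hq0 : 0 ≤ q := meanEdges_nonneg hn p
  have hqn : q ≤ (n : ℝ) ^ 2 := meanEdges_le hn hα hβ p
  have hθB0 : 0 ≤ θ * B := by positivity
  have hu0 : 0 ≤ u := by rw [hu]; positivity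
  set dev := {s : State n m | 2 * u ≤ ε * (numEdges s.2 - q)} with hdev
  have hdevm : MeasurableSet dev := measurableSet_le measurable_const
    (measurable_graph_observable fun G => ε * (numEdges G - q))
  -- Capping at the deviation threshold 2u gives the weight exactly exp(2θu) on `dev`. Where the
  -- deviation is below u the weight is at most exp(θu), and the ratio of the two is the gain.
  have hmain := h.integral_exp_mul_le hn hm hα hβ hθ hB (by linarith) (L := 2 * u)
    (by positivity) hε
  rw [← hq, show θ * (2 * u) = 2 * θ * u by ring] at hmain
  have hobs : Integrable (fun s : State n m => Real.exp (θ * min (ε * (numEdges s.2 - q)) (2 * u)) *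
      (ε * (numEdges s.2 - q) - θ * B * (q + numEdges s.2))) π := by
    let f : SimpleGraph (Fin n) → ℝ := fun G => Real.exp (θ * min (ε * (numEdges G - q)) (2 * u)) *
      (ε * (numEdges G - q) - θ * B * (q + numEdges G))
    refine Integrable.of_bound (measurable_graph_observable f).aestronglyMeasurable
      (∑ G, |f G|) (Eventually.of_forall fun s => ?_)
    exact Finset.single_le_sum (f := fun G => |f G|) (fun G _ => abs_nonneg _) (Finset.mem_univ _)
  have hdi : Integrable (dev.indicator (1 : State n m → ℝ)) π :=
    (integrable_const (1 : ℝ)).indicator hdevm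
  have hlow : ∫ s, (Real.exp (2 * θ * u) * u * dev.indicator 1 s -
      2 * n ^ 2 * Real.exp (θ * u)) ∂π ≤
      ∫ s, Real.exp (θ * min (ε * (numEdges s.2 - q)) (2 * u)) *
        (ε * (numEdges s.2 - q) - θ * B * (q + numEdges s.2)) ∂π := by
    refine integral_mono ((hdi.const_mul _).sub (integrable_const _)) hobs fun s => ?_
    simp only
    set Q := numEdges s.2 with hQ
    have hQ0 : 0 ≤ Q := numEdges_nonneg s.2
    have hQn : Q ≤ (n : ℝ) ^ 2 := numEdges_le s.2
    set y := ε * (Q - q) with hy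
    have hyabs : |y| = |Q - q| := by rw [hy, abs_mul, hε, one_mul]
    have hc : 0 ≤ 2 * (n : ℝ) ^ 2 * Real.exp (θ * u) := by positivity
    -- The choice of `u` gives 2θBq = u/4, and 8θB ≤ 1 absorbs the rest into y/8. Hence the
    -- integrand is nonnegative once y ≥ u, and its second factor is at least 3u/2 once y ≥ 2u.
    have hlin : u ≤ y → 7 / 8 * y - u / 4 ≤ y - θ * B * (q + Q) := by
      intro huy
      have h1 : Q - q ≤ y := by
        have := le_abs_self (Q - q)
        rw [← hyabs, abs_of_nonneg (hu0.trans huy)] at this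
        exact this
      have h2 : θ * B * (q + Q) ≤ θ * B * (2 * q + y) :=
        mul_le_mul_of_nonneg_left (by linarith) hθB0
      have h3 : θ * B * y ≤ 1 / 8 * y := mul_le_mul_of_nonneg_right (by linarith) (hu0.trans huy)
      have h4 : θ * B * (2 * q + y) = u / 4 + θ * B * y := by rw [hu]; ring
      linarith
    by_cases h1 : s ∈ dev
    · have h1' : 2 * u ≤ y := h1
      rw [Set.indicator_of_mem h1, min_eq_right h1', show θ * (2 * u) = 2 * θ * u by ring]
      have h2 := hlin (by linarith)
      have h3 : Real.exp (2 * θ * u) * u ≤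
          Real.exp (2 * θ * u) * (y - θ * B * (q + Q)) := by
        gcongr
        linarith
      simp only [Pi.one_apply, mul_one]
      linarith
    · rw [Set.indicator_of_notMem h1, mul_zero, zero_sub]
      by_cases h2 : u ≤ y
      · have h3 := hlin h2
        have h4 : 0 ≤ Real.exp (θ * min y (2 * u)) * (y - θ * B * (q + Q)) :=
          mul_nonneg (Real.exp_pos _).le (by linarith)
        linarith
      · have h3 : Real.exp (θ * min y (2 * u)) ≤ Real.exp (θ * u) := by
          gcongr
          exact (min_le_left _ _).trans (not_le.1 h2).le
        have h4 : -(2 * (n : ℝ) ^ 2) ≤ y - θ * B * (q + Q) := by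
          have h5 : -(n : ℝ) ^ 2 ≤ y := by
            have h6 : |y| ≤ (n : ℝ) ^ 2 := by
              rw [hyabs, abs_le]; constructor <;> linarith
            exact (abs_le.1 h6).1
          have h7 : θ * B * (q + Q) ≤ 1 / 8 * (2 * (n : ℝ) ^ 2) :=
            mul_le_mul (by linarith) (by linarith) (by linarith) (by norm_num)
          nlinarith [sq_nonneg (n : ℝ)]
        have h5 := mul_le_mul_of_nonneg_left h4 (Real.exp_pos (θ * min y (2 * u))).le
        have h6 := mul_le_mul_of_nonneg_right h3 (by positivity : 0 ≤ 2 * (n : ℝ) ^ 2)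
        linarith
  rw [integral_sub (hdi.const_mul _) (integrable_const _), integral_const_mul,
    integral_indicator_one hdevm, integral_const, probReal_univ, one_smul] at hlow
  linarith

/-! ### Asymptotics of the mean number of edges -/

/-- Bernoulli's inequality (1 + t)^s ≤ 1 + st with t = -1/(x + 1); its companion below takes t =
1/x. -/
theorem rpow_mul_le_rpow_sub_rpow {s x : ℝ} (hs0 : 0 < s) (hs1 : s ≤ 1) (hx : 0 ≤ x) :
    s * (x + 1) ^ (s - 1) ≤ (x + 1) ^ s - x ^ s := by
  have hx1 : 0 < x + 1 := by linarith
  have h1 : x = (x + 1) * (1 + -(1 / (x + 1))) := by field_simp; ring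
  have h2 : 1 / (x + 1) ≤ 1 := by rw [div_le_one hx1]; linarith
  have h3 : x ^ s ≤ (x + 1) ^ s * (1 + s * -(1 / (x + 1))) := by
    conv_lhs => rw [h1]
    rw [Real.mul_rpow hx1.le (by linarith)]
    gcongr
    exact rpow_one_add_le_one_add_mul_self (by linarith) hs0.le hs1
  rw [Real.rpow_sub_one hx1.ne']
  have h4 : (x + 1) ^ s * (1 + s * -(1 / (x + 1))) =
      (x + 1) ^ s - s * ((x + 1) ^ s / (x + 1)) := by ring
  linarith

theorem rpow_sub_rpow_le_mul_rpow {s x : ℝ} (hs0 : 0 < s) (hs1 : s ≤ 1) (hx : 0 < x) :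
    (x + 1) ^ s - x ^ s ≤ s * x ^ (s - 1) := by
  have h1 : x + 1 = x * (1 + 1 / x) := by field_simp
  have h2 : (0 : ℝ) ≤ 1 / x := by positivity
  have h3 : (x + 1) ^ s ≤ x ^ s * (1 + s * (1 / x)) := by
    rw [h1, Real.mul_rpow hx.le (by linarith)]
    gcongr
    exact rpow_one_add_le_one_add_mul_self (by linarith) hs0.le hs1
  rw [Real.rpow_sub_one hx.ne']
  have h4 : x ^ s * (1 + s * (1 / x)) = x ^ s + s * (x ^ s / x) := by ring
  linarith

/-- (1 - α) r^(-α) lies between consecutive differences of the power 1 - α. Telescoping puts (1 - α)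
times the sum between n^(1-α) - 1 and n^(1-α); the lower comparison is shifted by one to stay away
from the singularity at 0. -/
theorem tendsto_sum_rpow_neg_div (hα₀ : 0 ≤ α) (hα₁ : α < 1) :
    Tendsto (fun n : ℕ => (∑ i ∈ Finset.range n, ((i : ℝ) + 1) ^ (-α)) / (n : ℝ) ^ (1 - α))
      atTop (𝓝 (1 / (1 - α))) := by
  have hs0 : 0 < 1 - α := by linarith
  have hs1 : 1 - α ≤ 1 := by linarith
  have hexp : 1 - α - 1 = -α := by ring
  have hup : ∀ n : ℕ, (1 - α) * ∑ i ∈ Finset.range n, ((i : ℝ) + 1) ^ (-α) ≤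
      (n : ℝ) ^ (1 - α) := by
    intro n
    rw [Finset.mul_sum]
    calc ∑ i ∈ Finset.range n, (1 - α) * ((i : ℝ) + 1) ^ (-α)
        ≤ ∑ i ∈ Finset.range n, (((i + 1 : ℕ) : ℝ) ^ (1 - α) - (i : ℝ) ^ (1 - α)) := by
          refine Finset.sum_le_sum fun i _ => ?_
          have := rpow_mul_le_rpow_sub_rpow hs0 hs1 (Nat.cast_nonneg (α := ℝ) i)
          rw [hexp] at this
          simpa using this
      _ = (n : ℝ) ^ (1 - α) := by
          rw [Finset.sum_range_sub fun i : ℕ => (i : ℝ) ^ (1 - α)]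
          simp [Real.zero_rpow hs0.ne']
  have hlow : ∀ n : ℕ, (n : ℝ) ^ (1 - α) - 1 ≤
      (1 - α) * ∑ i ∈ Finset.range n, ((i : ℝ) + 1) ^ (-α) := by
    intro n
    rw [Finset.mul_sum]
    calc (n : ℝ) ^ (1 - α) - 1 ≤ ((n : ℝ) + 1) ^ (1 - α) - 1 := by gcongr; linarith
      _ = ∑ i ∈ Finset.range n, ((((i + 1 : ℕ) : ℝ) + 1) ^ (1 - α) -
            ((i : ℝ) + 1) ^ (1 - α)) := by
          rw [Finset.sum_range_sub fun i : ℕ => ((i : ℝ) + 1) ^ (1 - α)]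
          simp
      _ ≤ _ := by
          refine Finset.sum_le_sum fun i _ => ?_
          have := rpow_sub_rpow_le_mul_rpow hs0 hs1 (x := (i : ℝ) + 1) (by positivity)
          rw [hexp] at this
          simpa using this
  have hpow : Tendsto (fun n : ℕ => (n : ℝ) ^ (1 - α)) atTop atTop :=
    (tendsto_rpow_atTop hs0).comp tendsto_natCast_atTop_atTop
  have hl : Tendsto (fun n : ℕ => (1 - ((n : ℝ) ^ (1 - α))⁻¹) / (1 - α)) atTop
      (𝓝 (1 / (1 - α))) := by
    have h := ((tendsto_const_nhds (x := (1 : ℝ))).sub hpow.inv_tendsto_atTop).div_const (1 - α)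
    rw [sub_zero] at h
    exact h
  refine tendsto_of_tendsto_of_tendsto_of_le_of_le' hl tendsto_const_nhds ?_ ?_
  · filter_upwards [eventually_ge_atTop 1] with n hn
    have hn0 : (0 : ℝ) < (n : ℝ) ^ (1 - α) := Real.rpow_pos_of_pos (by exact_mod_cast hn) _
    rw [div_le_div_iff₀ hs0 hn0]
    have := hlow n
    have h2 : (1 - ((n : ℝ) ^ (1 - α))⁻¹) * (n : ℝ) ^ (1 - α) = (n : ℝ) ^ (1 - α) - 1 := by
      rw [sub_mul, inv_mul_cancel₀ hn0.ne', one_mul]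
    linarith
  · filter_upwards [eventually_ge_atTop 1] with n hn
    have hn0 : (0 : ℝ) < (n : ℝ) ^ (1 - α) := Real.rpow_pos_of_pos (by exact_mod_cast hn) _
    rw [div_le_div_iff₀ hn0 hs0]
    linarith [hup n]

theorem sum_regionVolume (n : ℕ) (α β : ℝ) :
    ∑ b, regionVolume n α β b =
      (∑ i ∈ Finset.range n, ((i : ℝ) + 1) ^ (-α)) * (n : ℝ) ^ (-β) := by
  rw [Finset.sum_mul, ← Fin.sum_univ_eq_sum_range (fun i => ((i : ℝ) + 1) ^ (-α) * (n : ℝ) ^ (-β))]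
  rfl

/-- The leading term of the number of edges. -/
def edgeScale (α β : ℝ) (p : unitInterval) (n : ℕ) : ℝ :=
  p / (2 * (1 - α)) * (n : ℝ) ^ (2 - α - β)

theorem edgeScale_pos (hα₁ : α < 1) {p : unitInterval} (hp : 0 < (p : ℝ)) (hn : 1 ≤ n) :
    0 < edgeScale α β p n := by
  have : (0 : ℝ) < n := by exact_mod_cast hn
  have : 0 < 1 - α := by linarith
  unfold edgeScale
  positivity

theorem tendsto_meanEdges_div_edgeScale (hα₀ : 0 ≤ α) (hα₁ : α < 1) {p : unitInterval}
    (hp : 0 < (p : ℝ)) :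
    Tendsto (fun n => meanEdges n α β p / edgeScale α β p n) atTop (𝓝 1) := by
  have hs0 : 0 < 1 - α := by linarith
  have h1 : Tendsto (fun n : ℕ => 1 - 1 / (n : ℝ)) atTop (𝓝 1) := by
    simpa using tendsto_const_nhds.sub (tendsto_one_div_atTop_nhds_zero_nat (𝕜 := ℝ))
  have h2 := (h1.mul (tendsto_sum_rpow_neg_div hα₀ hα₁)).const_mul (1 - α)
  rw [one_mul, mul_one_div_cancel hs0.ne'] at h2
  refine h2.congr' ?_
  filter_upwards [eventually_ge_atTop 1] with n hn
  have hn0 : (0 : ℝ) < n := by exact_mod_cast hn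
  have h3 : (n : ℝ) ^ (2 - α - β) = n * (n : ℝ) ^ (1 - α) * (n : ℝ) ^ (-β) := by
    rw [← Real.rpow_one_add' hn0.le (by linarith), ← Real.rpow_add hn0]
    ring_nf
  rw [meanEdges, meanNewDeg, sum_regionVolume, edgeScale, h3]
  have h4 : (0 : ℝ) < (n : ℝ) ^ (1 - α) := by positivity
  have h5 : (0 : ℝ) < (n : ℝ) ^ (-β) := by positivity
  field_simp

/-! ### Choice of parameters and extreme probability -/

theorem eventually_mul_log_sq_le (M : ℝ) {c δ : ℝ} (hc : 0 < c) (hδ : 0 < δ) :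
    ∀ᶠ n : ℕ in atTop, M * Real.log n ^ 2 ≤ c * (n : ℝ) ^ δ := by
  have h := (isLittleO_log_rpow_rpow_atTop 2 hδ).comp_tendsto tendsto_natCast_atTop_atTop
  have h2 := h.bound (c := c / (|M| + 1)) (by positivity)
  filter_upwards [h2] with n hn
  simp only [Function.comp_apply, Real.rpow_two, Real.norm_eq_abs] at hn
  rw [abs_of_nonneg (sq_nonneg _), abs_of_nonneg (Real.rpow_nonneg (Nat.cast_nonneg n) δ), div_mul_eq_mul_div,
    le_div_iff₀ (by positivity)] at hn
  refine le_trans ?_ hn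
  nlinarith [sq_nonneg (Real.log n), le_abs_self M]

theorem eventually_one_le_log : ∀ᶠ n : ℕ in atTop, 1 ≤ Real.log n :=
  (Real.tendsto_log_atTop.comp tendsto_natCast_atTop_atTop).eventually_ge_atTop 1

/-- A deviation bound for the number of edges in terms of the parameters of the exponential
functional. -/
theorem IsGeoP.measureReal_deviation_le (hn : 1 ≤ n) (hm : 1 ≤ m) (hα : 0 ≤ α) (hβ : 0 ≤ β)
    (hβ1 : β ≤ 1) {p : unitInterval} {ν : Measure (Fin n)} [IsProbabilityMeasure ν]
    {π : Measure (State n m)} (h : IsGeoP α β p ν π) {θ B : ℝ} (hθ : 0 < θ) (hθ1 : θ ≤ 1)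
    (hB : 0 ≤ B) (hθB : 8 * θ * B ≤ 1) {ε : ℝ} (hε : |ε| = 1) {u : ℝ}
    (hu : u = 8 * θ * B * meanEdges n α β p) (hu1 : 1 ≤ θ * u) :
    π.real {s | 2 * u ≤ ε * (numEdges s.2 - meanEdges n α β p)} ≤
      2 * n ^ 2 * Real.exp (-(θ * u)) +
      12 * n ^ 4 * Real.exp (-((n : ℝ) ^ (β - 1) / 4 * B)) := by
  have := h.isProbabilityMeasure
  have hn1 : (1 : ℝ) ≤ n := by exact_mod_cast hn
  have h1 := h.exp_mul_measureReal_le hn hm hα hβ hθ hB hθB hε hu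
  have h2 := h.measureReal_exists_deg_gt_le hn hm hα hβ hβ1 B
  set E := Real.exp (-((n : ℝ) ^ (β - 1) / 4 * B)) with hE
  set T := π.real {s | 2 * u ≤ ε * (numEdges s.2 - meanEdges n α β p)} with hT
  have hT0 : 0 ≤ T := measureReal_nonneg
  have hexp : Real.exp (2 * θ * u) = Real.exp (θ * u) * Real.exp (θ * u) := by
    rw [← Real.exp_add]; ring_nf
  have hX : 0 < Real.exp (θ * u) := Real.exp_pos _
  rw [hexp] at h1
  set X := Real.exp (θ * u) with hXdef
  have hbad0 : 0 ≤ π.real {s : State n m | ∃ k, B < deg s.2 k} := measureReal_nonneg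
  set b := π.real {s : State n m | ∃ k, B < deg s.2 k} with hb
  have hn2 : (1 : ℝ) ≤ (n : ℝ) ^ 2 := one_le_pow₀ hn1
  have h3 : 1 + 2 * θ * (n : ℝ) ^ 2 ≤ 3 * (n : ℝ) ^ 2 := by nlinarith
  -- The factor exp(2θu) that the cap puts on the probability of a large degree also stands before
  -- the deviation probability and cancels. The constant 12 is 3·4, from 3n² and the 4n of the
  -- degree tail.
  have h4 : X * X * T ≤ X * X * (2 * n ^ 2 * X⁻¹ + 12 * n ^ 4 * E) := by
    calc X * X * T ≤ X * X * (θ * u) * T := by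
          refine mul_le_mul_of_nonneg_right ?_ hT0
          exact le_mul_of_one_le_right (by positivity) hu1
      _ = θ * (X * X * u * T) := by ring
      _ ≤ θ * (2 * n ^ 2 * X + n / θ * (X * X * (1 + 2 * θ * n ^ 2)) * b) := by gcongr
      _ = θ * (2 * n ^ 2 * X) + n * (X * X * (1 + 2 * θ * n ^ 2)) * b := by field_simp
      _ ≤ 1 * (2 * n ^ 2 * X) + n * (X * X * (3 * n ^ 2)) * (4 * n * E) := by gcongr
      _ = X * X * (2 * n ^ 2 * X⁻¹ + 12 * n ^ 4 * E) := by field_simp; ring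
  have h5 := le_of_mul_le_mul_left h4 (by positivity)
  rwa [Real.exp_neg, ← hXdef]

/-- As log n ≤ log² n, the polynomials cost at most 4 log² n and 8 log² n in the exponent, which
leaves 2 log² n of the assumed 6 and 10. -/
theorem polynomial_mul_exp_le (hn : 1 ≤ n) (hlog : 1 ≤ Real.log n) {a b : ℝ}
    (ha : 6 * Real.log n ^ 2 ≤ a) (hb : 10 * Real.log n ^ 2 ≤ b) :
    2 * (n : ℝ) ^ 2 * Real.exp (-a) + 12 * n ^ 4 * Real.exp (-b) ≤
      Real.exp (-(2 * Real.log n ^ 2)) := by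
  have hn0 : (0 : ℝ) < n := by exact_mod_cast hn
  have hloglog : Real.log n ≤ Real.log n ^ 2 := by nlinarith
  have hexp1 : (2 : ℝ) ≤ Real.exp (Real.log n) := by
    linarith [Real.add_one_le_exp (Real.log n)]
  have hnexp : (n : ℝ) = Real.exp (Real.log n) := (Real.exp_log hn0).symm
  have hn2 : (2 : ℝ) ≤ n := by rw [hnexp]; exact hexp1
  have e1 : 2 * (n : ℝ) ^ 2 * Real.exp (-a) ≤
      1 / 2 * Real.exp (-(2 * Real.log n ^ 2)) := by
    have h2 : 2 * (n : ℝ) ^ 2 ≤ 1 / 2 * Real.exp (4 * Real.log n) := by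
      rw [show (4 : ℝ) * Real.log n = ((4 : ℕ) : ℝ) * Real.log n by norm_num,
        Real.exp_nat_mul, ← hnexp]
      nlinarith [mul_le_mul hn2 hn2 (by norm_num) (by linarith), sq_nonneg (n : ℝ)]
    calc 2 * (n : ℝ) ^ 2 * Real.exp (-a)
        ≤ 1 / 2 * Real.exp (4 * Real.log n) * Real.exp (-a) := by gcongr
      _ = 1 / 2 * Real.exp (4 * Real.log n + -(a)) := by rw [Real.exp_add]; ring
      _ ≤ _ := by
          gcongr
          linarith
  have e2 : 12 * (n : ℝ) ^ 4 * Real.exp (-b) ≤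
      1 / 2 * Real.exp (-(2 * Real.log n ^ 2)) := by
    have hn3 : (2.7 : ℝ) ≤ n := by
      rw [hnexp]
      have := Real.exp_le_exp.2 hlog
      linarith [Real.exp_one_gt_d9]
    have h2 : 12 * (n : ℝ) ^ 4 ≤ 1 / 2 * Real.exp (8 * Real.log n) := by
      rw [show (8 : ℝ) * Real.log n = ((8 : ℕ) : ℝ) * Real.log n by norm_num,
        Real.exp_nat_mul, ← hnexp]
      have h3 : (24 : ℝ) ≤ n ^ 4 :=
        le_trans (by norm_num) (pow_le_pow_left₀ (by norm_num) hn3 4)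
      have h4 : (n : ℝ) ^ 8 = n ^ 4 * n ^ 4 := by ring
      rw [h4]
      nlinarith [mul_le_mul_of_nonneg_right h3 (by positivity : (0 : ℝ) ≤ (n : ℝ) ^ 4)]
    calc 12 * (n : ℝ) ^ 4 * Real.exp (-b)
        ≤ 1 / 2 * Real.exp (8 * Real.log n) * Real.exp (-b) := by
          gcongr
      _ = 1 / 2 * Real.exp (8 * Real.log n + -(b)) := by
          rw [Real.exp_add]; ring
      _ ≤ _ := by
          gcongr
          linarith
  linarith

theorem exp_add_exp_le {l : ℝ} (hl : 1 ≤ l) :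
    Real.exp (-(2 * l)) + Real.exp (-(2 * l)) ≤ Real.exp (-(1 * l)) := by
  have h1 : Real.exp (-(2 * l)) = Real.exp (-(1 * l)) * Real.exp (-(1 * l)) := by
    rw [← Real.exp_add]; ring_nf
  have h2 : Real.exp (-(1 * l)) ≤ 1 / 2 := by
    rw [Real.exp_neg, inv_le_comm₀ (Real.exp_pos _) (by norm_num)]
    linarith [Real.add_one_le_exp (1 * l)]
  rw [h1]
  nlinarith [Real.exp_pos (-(1 * l))]

/-- Two deviation bounds around `q` give concentration around `x`. -/
theorem le_measureReal_abs_numEdges_sub_le (π : Measure (State n m)) [IsProbabilityMeasure π]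
    {q u w b : ℝ} (hb : ∀ e : ℝ, |e| = 1 → π.real {s | 2 * u ≤ e * (numEdges s.2 - q)} ≤ b)
    (x : ℝ) (hw : w = 2 * u + |q - x|) :
    1 - (b + b) ≤ π.real {s | |numEdges s.2 - x| ≤ w} := by
  have hsub : {s : State n m | |numEdges s.2 - x| ≤ w}ᶜ ⊆
      {s | 2 * u ≤ 1 * (numEdges s.2 - q)} ∪ {s | 2 * u ≤ -1 * (numEdges s.2 - q)} := by
    intro s hs
    have hs' : ¬ |numEdges s.2 - x| ≤ w := hs
    by_contra hc
    simp only [Set.mem_union, Set.mem_ofPred_eq, not_or, not_le] at hc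
    have h1 : |numEdges s.2 - q| ≤ 2 * u := by
      rw [abs_le]; constructor <;> linarith [hc.1, hc.2]
    exact hs' ((abs_sub_le _ q _).trans (by linarith))
  have hmeas : MeasurableSet {s : State n m | |numEdges s.2 - x| ≤ w} :=
    measurableSet_le (measurable_graph_observable fun G => |numEdges G - x|) measurable_const
  have hcompl := (measureReal_mono hsub).trans ((measureReal_union_le _ _).trans
    (add_le_add (hb 1 (by simp)) (hb (-1) (by simp))))
  rw [probReal_compl_eq_one_sub hmeas] at hcompl
  linarith

theorem exists_wep_numEdges (α β : ℝ) (p : unitInterval) (hα₀ : 0 < α) (hα₁ : α < 1)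
    (hβ₀ : 0 < β) (hβ₁ : β < 1 - α) (hp : 0 < (p : ℝ))
    (m : ℕ → ℕ) (hm : ∀ n, 1 ≤ m n)
    (ν : ∀ n : ℕ, Measure (Fin n)) (hν : ∀ n, 1 ≤ n → IsProbabilityMeasure (ν n))
    (π : ∀ n : ℕ, Measure (State n (m n))) (hπ : ∀ n, 1 ≤ n → IsGeoP α β p (ν n) (π n)) :
    ∃ ε : ℕ → ℝ, Tendsto ε atTop (𝓝 0) ∧ ∀ᶠ n : ℕ in atTop,
      1 - Real.exp (-(1 * Real.log n ^ 2)) ≤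
        (π n).real {s | |numEdges s.2 - edgeScale α β p n| ≤ ε n * edgeScale α β p n} := by
  set κ := 1 - α with hκ
  have hκ0 : 0 < κ := by linarith
  -- B exceeds n^(1-β) by the factor n^(κ/2), so a larger degree has probability at most 4n
  -- exp(-n^(κ/2)/4). The relative error `η` fixes θ through 8θB = η, and then u = ηq. As q/B has
  -- order n^(κ/2), the exponent θu = η²q/(8B) has order n^(κ/4), which beats log² n.
  let B : ℕ → ℝ := fun n => (n : ℝ) ^ (1 - β + κ / 2)
  let η : ℕ → ℝ := fun n => (n : ℝ) ^ (-(κ / 8))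
  let θ : ℕ → ℝ := fun n => η n / (8 * B n)
  let u : ℕ → ℝ := fun n => η n * meanEdges n α β p
  have hratio := tendsto_meanEdges_div_edgeScale (β := β) hα₀.le hα₁ hp
  have hη : Tendsto η atTop (𝓝 0) :=
    (tendsto_rpow_neg_atTop (by positivity : 0 < κ / 8)).comp tendsto_natCast_atTop_atTop
  -- The first summand is the fluctuation 2u around the mean, the second the bias of the mean, both
  -- relative to `edgeScale`.
  refine ⟨fun n => 2 * (η n * (meanEdges n α β p / edgeScale α β p n)) +
    |meanEdges n α β p / edgeScale α β p n - 1|, ?_, ?_⟩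
  · have h1 := ((hη.mul hratio).const_mul 2).add (hratio.sub_const 1).abs
    simpa using h1
  · have hc : 0 < (p : ℝ) / (32 * κ) := by positivity
    filter_upwards [eventually_ge_atTop 1, eventually_one_le_log,
      eventually_mul_log_sq_le 6 hc (by positivity : 0 < κ / 4),
      eventually_mul_log_sq_le 10 (by norm_num : (0 : ℝ) < 1 / 4) (by positivity : 0 < κ / 2),
      hratio.eventually (lt_mem_nhds (by norm_num : (1 / 2 : ℝ) < 1))] with n hn hlog hA hB2 hr
    have := hν n hn
    have h := hπ n hn
    have := h.isProbabilityMeasure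
    have hn0 : (0 : ℝ) < n := by exact_mod_cast hn
    have hn1 : (1 : ℝ) ≤ n := by exact_mod_cast hn
    set q := meanEdges n α β p with hq
    set x := edgeScale α β p n with hx
    have hx0 : 0 < x := edgeScale_pos hα₁ hp hn
    have hBpos : 0 < B n := by positivity
    have hB1 : 1 ≤ B n := Real.one_le_rpow hn1 (by linarith)
    have hηpos : 0 < η n := by positivity
    have hη1 : η n ≤ 1 := Real.rpow_le_one_of_one_le_of_nonpos hn1 (by linarith)
    have hθpos : 0 < θ n := by positivity
    have hθB : 8 * θ n * B n = η n := by simp only [θ]; field_simp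
    have hθ1 : θ n ≤ 1 := by nlinarith
    have hu : u n = 8 * θ n * B n * q := by rw [hθB]
    have hqx : x / 2 ≤ q := by
      rw [lt_div_iff₀ hx0] at hr
      linarith
    -- Written with x/2 in place of q, which is eventually a lower bound; this turns the denominator
    -- 8B into 16B.
    have hscale : η n * η n * x / (16 * B n) = p / (32 * κ) * (n : ℝ) ^ (κ / 4) := by
      have h1 : (n : ℝ) ^ (κ / 4) * B n = η n * η n * (n : ℝ) ^ (2 - α - β) := by
        simp only [B, η]
        rw [← Real.rpow_add hn0, ← Real.rpow_add hn0, ← Real.rpow_add hn0]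
        congr 1
        rw [hκ]; ring
      rw [div_eq_iff (by positivity), hx, edgeScale]
      calc η n * η n * (p / (2 * κ) * (n : ℝ) ^ (2 - α - β))
          = p / (2 * κ) * (η n * η n * (n : ℝ) ^ (2 - α - β)) := by ring
        _ = p / (2 * κ) * ((n : ℝ) ^ (κ / 4) * B n) := by rw [h1]
        _ = _ := by field_simp; ring
    have hθu : 6 * Real.log n ^ 2 ≤ θ n * u n := by
      refine hA.trans ?_
      rw [← hscale]
      have h1 : θ n * u n = η n * η n * q / (8 * B n) := by simp only [θ, u]; ring
      rw [h1, div_le_div_iff₀ (by positivity) (by positivity)]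
      have h2 := mul_le_mul_of_nonneg_left hqx
        (by positivity : 0 ≤ η n * η n * (16 * B n))
      linarith
    have hlog2 : 1 ≤ Real.log n ^ 2 := one_le_pow₀ hlog
    have hBexp : (n : ℝ) ^ (β - 1) / 4 * B n = 1 / 4 * (n : ℝ) ^ (κ / 2) := by
      simp only [B]
      rw [div_mul_eq_mul_div, ← Real.rpow_add hn0]
      ring_nf
    have hdev : ∀ e : ℝ, |e| = 1 → (π n).real {s | 2 * u n ≤ e * (numEdges s.2 - q)} ≤
        Real.exp (-(2 * Real.log n ^ 2)) := by
      intro e he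
      have h1 := h.measureReal_deviation_le hn (hm n) hα₀.le hβ₀.le (by linarith) hθpos hθ1
        hBpos.le (hθB.trans_le hη1) he hu (by linarith)
      rw [hBexp] at h1
      refine h1.trans ?_
      exact polynomial_mul_exp_le hn hlog hθu hB2
    have hw : (2 * (η n * (q / x)) + |q / x - 1|) * x = 2 * u n + |q - x| := by
      have h1 : |q - x| = |q / x - 1| * x := by
        conv_rhs => rw [← abs_of_pos hx0, ← abs_mul, abs_of_pos hx0]
        congr 1
        field_simp
      rw [h1, show u n = η n * q from rfl, add_mul]
      congr 1
      field_simp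
    have h1 := le_measureReal_abs_numEdges_sub_le (π n) hdev x hw
    linarith [exp_add_exp_le hlog2]

end GeoP

end

/-- The average degree and its target are both 2/n times their edge counterparts, so the events
coincide for n ≥ 1 and the same error sequence serves both claims. -/
theorem theorem3p2 (α β : ℝ) (p : unitInterval) (hα₀ : 0 < α) (hα₁ : α < 1)
    (hβ₀ : 0 < β) (hβ₁ : β < 1 - α) (hp : 0 < (p : ℝ))
    (m : ℕ → ℕ) (hm : ∀ n, 1 ≤ m n)
    (ν : ∀ n : ℕ, Measure (Fin n)) (hν : ∀ n, 1 ≤ n → IsProbabilityMeasure (ν n)) :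
    (∀ n, 1 ≤ n → ∃! π : Measure (GeoP.State n (m n)), GeoP.IsGeoP α β p (ν n) π) ∧
    ∀ π : ∀ n : ℕ, Measure (GeoP.State n (m n)),
      (∀ n, 1 ≤ n → GeoP.IsGeoP α β p (ν n) (π n)) →
        GeoP.WepAsymptotic π (fun _ s => GeoP.avgDegree s.2)
          (fun n => (p : ℝ) / (1 - α) * (n : ℝ) ^ (1 - α - β)) ∧
        GeoP.DensificationPowerLaw π (2 - α - β) := by
  refine ⟨fun n hn => ?_, fun π hπ => ?_⟩
  · have := hν n hn
    obtain ⟨π, h⟩ := GeoP.exists_isGeoP (m := m n) (α := α) (β := β) hn p (ν n)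
    exact ⟨π, h, fun π' h' => h'.eq hn h⟩
  · obtain ⟨ε, hε, hA⟩ := GeoP.exists_wep_numEdges α β p hα₀ hα₁ hβ₀ hβ₁ hp m hm ν hν π hπ
    have hs : 0 < 1 - α := by linarith
    refine ⟨⟨ε, hε, 1, one_pos, ?_⟩, by linarith, by linarith, p / (2 * (1 - α)), by positivity,
      ε, hε, 1, one_pos, hA⟩
    filter_upwards [hA, eventually_ge_atTop 1] with n hn hn1
    refine hn.trans_eq ?_
    congr 1
    ext s
    have hn0 : (0 : ℝ) < n := by exact_mod_cast hn1
    have h1 : (p : ℝ) / (1 - α) * (n : ℝ) ^ (1 - α - β) = 2 / n * GeoP.edgeScale α β p n := by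
      rw [GeoP.edgeScale, show 2 - α - β = 1 + (1 - α - β) by ring, Real.rpow_add hn0,
        Real.rpow_one]
      field_simp
    have h2 : GeoP.avgDegree s.2 = 2 / n * GeoP.numEdges s.2 := by
      rw [GeoP.avgDegree]; ring
    rw [Set.mem_ofPred_eq, Set.mem_ofPred_eq, h1, h2, ← mul_sub, abs_mul, abs_of_pos (by positivity : (0 : ℝ) < 2 / n),
      show ε n * (2 / n * GeoP.edgeScale α β p n) = 2 / n * (ε n * GeoP.edgeScale α β p n) by ring,
      mul_le_mul_iff_right₀ (by positivity)]
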